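/- Fix integers $k,d\ge 1$, a norm index $\mathfrak p\in\{1,2,\dots\}\cup\{\infty\}$, a temperature $0<T<1$ and $\varepsilon>0$. Weighted geometric model. Let $\mathbb T^d=\mathbb R^d/\mathbb Z^d$ be the torus with the distance $\mathrm{dist}(x,y)=\big(\sum_{i}|x_i-y_i|_\circ^{\mathfrak p}\big)^{1/\mathfrak p}$ (for $\mathfrak p=\infty$: $\max_i|x_i-y_i|_\circ$), where $|a-b|_\circ=\min\{|a-b|,1-|a-b|\}$ for $a,b\in[0,1]$. There are $n$ variables $v\in V$ with weights $w_v$, normalized so that the smallest weight is $1$, and $m$ clauses; let $W=\sum_v w_v$. All variables and clauses get independent uniform positions in $\mathbb T^d$. The connection weight of a clause $c$ and a variable $v$ is $X(c,v)=\big(w_v/\mathrm{dist}(c,v)^d\big)^{1/T}$. Given the positions, each clause $c$, independently of the others, draws $k$ variables one after another, without repetition and with probabilities proportional to $X(c,\cdot)$. Finally the negations are chosen uniformly at random among all choices in which the same clause occurs twice only if more than $2^k$ clauses have the same variable set. A clause is called nice if for each $i\in\{1,\dots,k\}$ the $i$-th variable drawn for it has the $i$-th highest connection weight with it, i.e. in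 each step the variable with the highest connection weight among those not drawn before is drawn. Theorem. Suppose $m\in\Theta(n)$, $W\in O(n)$, and $w_v\in O(n^{1-\varepsilon})$ for every $v\in V$ (uniformly in $v$). Then, with high probability, i.e. with probability $1-O(1/n)$, $\Theta(m)$ clauses are nice. Explicitly: for all constants $\alpha>0$ and $\beta,B,D$ there are constants $a,b>0$, $K$ and $n_0$, depending only on $k,d,\mathfrak p,T,\varepsilon,\alpha,\beta,B,D$, such that for all $n\ge n_0$, all $m$ with $\alpha n\le m\le\beta n$, and all weights with $\min_v w_v=1$, $W\le Bn$ and $w_v\le Dn^{1-\varepsilon}$ for all $v$, the number $N$ of nice clauses satisfies $\Pr[a\,m\le N\le b\,m]\ge 1-K/n$. -/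

import Mathlib

/-- The `d`-dimensional torus `ℝᵈ / ℤᵈ`. Its `volume` is the uniform probability distribution
(independent uniform coordinates on the circle of length `1`). -/
abbrev Torus (d : ℕ) : Type := Fin d → UnitAddCircle

/-- The distance on the torus given by the `p`-norm, for `p ∈ {1, 2, …} ∪ {∞}`. The norm
`‖x i - y i‖` of `ℝ / ℤ` is the circular difference: for representatives `a`, `b` in `[0, 1]`
it is `min (|a - b|) (1 - |a - b|)`. -/
noncomputable def torusDist {d : ℕ} (p : ℕ∞) (x y : Torus d) : ℝ :=
  if p = ⊤ then ⨆ i, ‖x i - y i‖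
  else (∑ i, ‖x i - y i‖ ^ p.toNat) ^ (1 / (p.toNat : ℝ))

/-- The connection weight `(w / dist(c, v)ᵈ)^(1/T)` of a clause at position `c` and a variable
of weight `w` at position `v`. -/
noncomputable def connWeight {d : ℕ} (p : ℕ∞) (T w : ℝ) (c v : Torus d) : ℝ :=
  (w / torusDist p c v ^ d) ^ (1 / T)

/-- The variables that are still available in step `j` when drawing the sequence `t` without
repetition. -/
def remaining {n k : ℕ} (t : Fin k → Fin n) (j : Fin k) : Finset (Fin n) :=
  Finset.univ \ (Finset.Iio j).image t

/-- The probability that drawing `k` of `n` variables one after another, without repetition and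
with probabilities proportional to `X`, yields the sequence `t`. -/
noncomputable def drawProb {n k : ℕ} (X : Fin n → ℝ) (t : Fin k → Fin n) : ℝ :=
  if Function.Injective t then ∏ j, X (t j) / ∑ v ∈ remaining t j, X v else 0

/-- The set of literals of the clause whose `j`-th variable is `t j`, where `s j` tells whether
that variable is negated. -/
def literals {n k : ℕ} (t : Fin k → Fin n) (s : Fin k → Bool) : Finset (Fin n × Bool) :=
  Finset.univ.image fun j => (t j, s j)

/-- The choices of negations for `m` clauses with variables `t` in which the same clause occurs
twice only if more than `2 ^ k` clauses have the same variable set. -/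
def admissibleSigns {n m k : ℕ} (t : Fin m → Fin k → Fin n) : Set (Fin m → Fin k → Bool) :=
  {s | ∀ i i', i ≠ i' → literals (t i) (s i) = literals (t i') (s i') →
    2 ^ k < {l : Fin m | Set.range (t l) = Set.range (t i)}.ncard}

/-- The probability of the negations `s`, given the variables `t` of the clauses: the uniform
distribution on the admissible choices. -/
noncomputable def signProb {n m k : ℕ} (t : Fin m → Fin k → Fin n)
    (s : Fin m → Fin k → Bool) : ℝ :=
  (admissibleSigns t).indicator (fun _ => 1 / ((admissibleSigns t).ncard : ℝ)) s

/-- A formula with `n` variables and `m` clauses as it is generated by the geometric model: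
the positions of the variables and of the clauses, and for every clause the sequence of its `k`
variables in the order in which they were drawn, and which of them are negated. -/
abbrev GeomFormula (n m k d : ℕ) : Type :=
  ((Fin n → Torus d) × (Fin m → Torus d)) × ((Fin m → Fin k → Fin n) × (Fin m → Fin k → Bool))

namespace GeomFormula

variable {n m k d : ℕ}

/-- Position of variable `v`. -/
def varPos (Φ : GeomFormula n m k d) (v : Fin n) : Torus d := Φ.1.1 v

/-- Position of clause `i`. -/
def clausePos (Φ : GeomFormula n m k d) (i : Fin m) : Torus d := Φ.1.2 i

/-- The `j`-th variable drawn for clause `i` is `Φ.drawn i j`. -/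
def drawn (Φ : GeomFormula n m k d) : Fin m → Fin k → Fin n := Φ.2.1

/-- Whether the `j`-th variable of clause `i` is negated. -/
def negated (Φ : GeomFormula n m k d) : Fin m → Fin k → Bool := Φ.2.2

/-- The connection weight of clause `i` and variable `v`. -/
noncomputable def X (p : ℕ∞) (T : ℝ) (w : Fin n → ℝ) (Φ : GeomFormula n m k d)
    (i : Fin m) (v : Fin n) : ℝ :=
  connWeight p T (w v) (Φ.clausePos i) (Φ.varPos v)

/-- Clause `i` is nice: in each of the `k` steps, the variable drawn has the highest connection
weight among the variables not drawn before. -/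
def Nice (p : ℕ∞) (T : ℝ) (w : Fin n → ℝ) (Φ : GeomFormula n m k d) (i : Fin m) : Prop :=
  ∀ j : Fin k, Φ.drawn i j ∈ remaining (Φ.drawn i) j ∧
    ∀ v ∈ remaining (Φ.drawn i) j, Φ.X p T w i v ≤ Φ.X p T w i (Φ.drawn i j)

/-- The number of nice clauses. -/
noncomputable def numNice (p : ℕ∞) (T : ℝ) (w : Fin n → ℝ) (Φ : GeomFormula n m k d) : ℕ :=
  {i : Fin m | Φ.Nice p T w i}.ncard

end GeomFormula

/-- The weighted geometric model, as a distribution on formulas: the positions are independent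
and uniform on the torus; given the positions, the clauses draw their variables independently of
each other; given these, the negations are drawn. It is written through its density with respect
to the uniform distribution of the positions times the counting measure of the discrete part. -/
noncomputable def geometricModel (n m k d : ℕ) (p : ℕ∞) (T : ℝ) (w : Fin n → ℝ) :
    MeasureTheory.Measure (GeomFormula n m k d) :=
  ((MeasureTheory.volume : MeasureTheory.Measure ((Fin n → Torus d) × (Fin m → Torus d))).prod
      MeasureTheory.Measure.count).withDensity fun Φ : GeomFormula n m k d =>
    ENNReal.ofReal ((∏ i, drawProb (Φ.X p T w i) (Φ.drawn i)) * signProb Φ.drawn Φ.negated)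

/-! Every count is at most `m`, so only the lower bound has content. Fix the positions `V` of the
variables; the clauses are then independent and identically distributed. For all `V` outside an
event of probability `O(1/n)`, a single clause is nice with probability at least a constant `q`, and
a Chernoff bound finishes the proof.

For one clause, choose `ρ` so that a cube of side `2ρ` has volume `k/n`. The number of variables
within sup-distance `ρ` of a uniform clause position has mean exactly `k`. Its second moment is
controlled by the number of pairs of variables at distance at most `2ρ`; if this is `O(n)`, at least
`k` variables are that close with probability at least `1/(4Q)` (`le_volume_ballCount`). Each of
them has connection weight at least some `τ`. Conversely, the weights truncated at `τ` have total
expectation at most `Mτ`, because a connection weight has a power-law tail that is integrable near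
`0` when `T < 1` (`lintegral_min_connWeight_le`). By Markov's inequality, with probability at least
`1/(8Q)` there are `k` weights above `τ` and the truncated total is at most `Cτ`. Then each greedy
step has probability at least `1/C`, so the sorted draw has probability at least `C⁻ᵏ`
(`exists_sorted_drawProb_ge`). `lintegral_drawExp_le` combines these estimates.

The number of close pairs is controlled by Chebyshev's inequality: the centred pair indicators are
pairwise uncorrelated (`integral_pi_offDiag_sq_le`). This step is what limits the failure
probability to order `1/n`; the Chernoff error is exponentially small. `lintegral_geometricModel`
justifies conditioning on `V` by integrating out negations, draws and clause positions in turn. -/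

/-! ### Drawing without repetition. -/

theorem remaining_snoc_castSucc {n k : ℕ} (t : Fin k → Fin n) (a : Fin n) (j : Fin k) :
    remaining (Fin.snoc t a : Fin (k + 1) → Fin n) j.castSucc = remaining t j := by
  ext v
  simp only [remaining, Finset.mem_sdiff, Finset.mem_univ, true_and, Finset.mem_image,
    Finset.mem_Iio, not_exists, not_and]
  constructor
  · intro h i hi
    simpa using h i.castSucc (by simpa using hi)
  · intro h i hi
    induction i using Fin.lastCases with
    | last => exact absurd hi (not_lt.2 (Fin.le_last _))
    | cast i => simpa using h i (by simpa using hi)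

theorem remaining_snoc_last {n k : ℕ} (t : Fin k → Fin n) (a : Fin n) :
    remaining (Fin.snoc t a : Fin (k + 1) → Fin n) (Fin.last k) =
      Finset.univ \ Finset.univ.image t := by
  ext v
  simp only [remaining, Finset.mem_sdiff, Finset.mem_univ, true_and, Finset.mem_image,
    Finset.mem_Iio, not_exists, not_and]
  constructor
  · intro h i
    simpa using h i.castSucc (Fin.castSucc_lt_last i)
  · intro h i hi
    induction i using Fin.lastCases with
    | last => exact absurd hi (lt_irrefl _)
    | cast i => simpa using h i

/-- Splits off the last draw, which makes the total mass accessible to induction on `k`. -/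
theorem drawProb_snoc {n k : ℕ} (X : Fin n → ℝ) (t : Fin k → Fin n) (a : Fin n) :
    drawProb X (Fin.snoc t a : Fin (k + 1) → Fin n) =
      drawProb X t * if a ∈ Finset.univ \ Finset.univ.image t then
        X a / ∑ v ∈ Finset.univ \ Finset.univ.image t, X v else 0 := by
  have key : Function.Injective (Fin.snoc t a : Fin (k + 1) → Fin n) ↔
      Function.Injective t ∧ a ∈ Finset.univ \ Finset.univ.image t := by
    rw [Fin.snoc_injective_iff]
    simp
  unfold drawProb
  by_cases h1 : Function.Injective t
  · by_cases h2 : a ∈ Finset.univ \ Finset.univ.image t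
    · rw [if_pos (key.2 ⟨h1, h2⟩), if_pos h1, if_pos h2, Fin.prod_univ_castSucc]
      simp only [remaining_snoc_castSucc, remaining_snoc_last, Fin.snoc_castSucc, Fin.snoc_last]
    · rw [if_neg (fun h => h2 (key.1 h).2), if_neg h2, mul_zero]
  · rw [if_neg (fun h => h1 (key.1 h).1), if_neg h1, zero_mul]

theorem drawProb_nonneg {n k : ℕ} {X : Fin n → ℝ} (hX : ∀ v, 0 ≤ X v) (t : Fin k → Fin n) :
    0 ≤ drawProb X t := by
  unfold drawProb
  split_ifs
  · exact Finset.prod_nonneg fun j _ => div_nonneg (hX _) (Finset.sum_nonneg fun v _ => hX v)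
  · exact le_rfl

/-- The drawing probabilities sum up to `1`. -/
theorem sum_drawProb {n k : ℕ} (hk : k ≤ n) {X : Fin n → ℝ} (hX : ∀ v, 0 < X v) :
    ∑ t : Fin k → Fin n, drawProb X t = 1 := by
  induction k with
  | zero =>
    simp [drawProb, Function.injective_of_subsingleton]
  | succ k ih =>
    rw [← (Fin.snocEquiv fun _ : Fin (k + 1) => Fin n).sum_comp, Fintype.sum_prod_type_right]
    have : ∀ t : Fin k → Fin n, ∑ a : Fin n,
        drawProb X ((Fin.snocEquiv fun _ : Fin (k + 1) => Fin n) (a, t)) = drawProb X t := by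
      intro t
      have hne : (Finset.univ \ Finset.univ.image t).Nonempty := by
        rw [Finset.sdiff_nonempty]
        intro h
        have := Finset.card_le_card h
        have h2 := Finset.card_image_le (s := Finset.univ) (f := t)
        simp only [Finset.card_univ, Fintype.card_fin] at this h2
        omega
      have hpos : 0 < ∑ v ∈ Finset.univ \ Finset.univ.image t, X v :=
        Finset.sum_pos (fun v _ => hX v) hne
      calc _ = ∑ a : Fin n, drawProb X (Fin.snoc t a : Fin (k + 1) → Fin n) := rfl
        _ = drawProb X t * ∑ a ∈ Finset.univ \ Finset.univ.image t,
              X a / ∑ v ∈ Finset.univ \ Finset.univ.image t, X v := by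
            simp_rw [drawProb_snoc]
            rw [← Finset.mul_sum, ← Finset.sum_filter, Finset.filter_univ_mem]
        _ = drawProb X t := by
            rw [← Finset.sum_div, div_self hpos.ne', mul_one]
    simp_rw [this]
    exact ih (by omega)

/-- If at least `k` of the weights are at least `τ` and the weights truncated at `τ` have sum
at most `C * τ`, then some sequence of drawn variables is sorted by decreasing weight and has
probability at least `1 / C ^ k`. -/
theorem exists_sorted_drawProb_ge {n k : ℕ} {X : Fin n → ℝ} (hX : ∀ v, 0 < X v) {τ C : ℝ}
    (hτ : 0 < τ) (hC : ∑ v, min (X v / τ) 1 ≤ C)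
    (hk : k ≤ (Finset.univ.filter fun v => τ ≤ X v).card) :
    ∃ t : Fin k → Fin n, (∀ j, t j ∈ remaining t j ∧ ∀ v ∈ remaining t j, X v ≤ X (t j)) ∧
      (1 / C) ^ k ≤ drawProb X t := by
  have hkn : k ≤ n := hk.trans ((Finset.card_le_univ _).trans (by simp))
  -- Sorting the negated weights lists the variables by decreasing weight; `t` takes the first `k`
  -- of them.
  set σ := Tuple.sort (fun v => -X v)
  have hσ : ∀ i j, i ≤ j → X (σ j) ≤ X (σ i) := fun i j hij => by
    have := Tuple.monotone_sort (fun v => -X v) hij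
    simpa using this
  set t : Fin k → Fin n := fun j => σ (Fin.castLE hkn j)
  have htinj : Function.Injective t := σ.injective.comp (Fin.castLE_injective hkn)
  have hrem : ∀ j, ∀ v ∈ remaining t j, X v ≤ X (t j) := by
    intro j v hv
    obtain ⟨i, rfl⟩ := σ.surjective v
    refine hσ _ _ ?_
    by_contra hlt
    rw [not_le] at hlt
    simp only [remaining, Finset.mem_sdiff, Finset.mem_univ, true_and, Finset.mem_image,
      Finset.mem_Iio, not_exists, not_and] at hv
    have hij : i.val < j.val := hlt
    exact hv ⟨i.val, hij.trans j.2⟩ (by exact hij) rfl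
  have hmem : ∀ j, t j ∈ remaining t j := by
    intro j
    simp only [remaining, Finset.mem_sdiff, Finset.mem_univ, true_and, Finset.mem_image,
      Finset.mem_Iio, not_exists, not_and]
    intro i hi h
    exact hi.ne (htinj h)
  -- If `X (t j) < τ`, everything still available is below `τ` too, so the at least `k` variables
  -- above `τ` would all be among the `j < k` already drawn.
  have hbig : ∀ j, τ ≤ X (t j) := by
    intro j
    by_contra hlt
    rw [not_le] at hlt
    have hsub : (Finset.univ.filter fun v => τ ≤ X v) ⊆ (Finset.Iio j).image t := by
      intro v hv
      by_contra hv'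
      have := hrem j v (by simp only [remaining, Finset.mem_sdiff, Finset.mem_univ, true_and]; exact hv')
      simp only [Finset.mem_filter, Finset.mem_univ, true_and] at hv
      linarith
    have := (hk.trans (Finset.card_le_card hsub)).trans Finset.card_image_le
    rw [Fin.card_Iio] at this
    have := j.2
    omega
  refine ⟨t, fun j => ⟨hmem j, hrem j⟩, ?_⟩
  unfold drawProb
  rw [if_pos htinj]
  have hmin0 : ∀ v, 0 ≤ min (X v / τ) 1 := fun v => le_min (div_pos (hX v) hτ).le zero_le_one
  have : ((1 : ℝ) / C) ^ k = ∏ _j : Fin k, 1 / C := by simp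
  rw [this]
  have hC0 : 0 ≤ C := (Finset.sum_nonneg fun v _ => hmin0 v).trans hC
  refine Finset.prod_le_prod (fun _ _ => by positivity) fun j _ => ?_
  -- Since `X (t j)` is both at least `τ` and maximal among the available weights, each `X v` is at
  -- most its truncated ratio times `X (t j)`. Hence every factor of the drawing probability is at
  -- least `1 / C`.
  have hsum : ∑ v ∈ remaining t j, X v ≤ C * X (t j) := by
    calc ∑ v ∈ remaining t j, X v ≤ ∑ v ∈ remaining t j, min (X v / τ) 1 * X (t j) := by
          refine Finset.sum_le_sum fun v hv => ?_
          rcases le_total (X v / τ) 1 with h | h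
          · rw [min_eq_left h]
            calc X v = X v / τ * τ := by field_simp
              _ ≤ _ := mul_le_mul_of_nonneg_left (hbig j) (div_pos (hX v) hτ).le
          · rw [min_eq_right h, one_mul]
            exact hrem j v hv
      _ = (∑ v ∈ remaining t j, min (X v / τ) 1) * X (t j) := by rw [Finset.sum_mul]
      _ ≤ C * X (t j) := by
          refine mul_le_mul_of_nonneg_right (le_trans ?_ hC) (hX _).le
          exact Finset.sum_le_sum_of_subset_of_nonneg (Finset.subset_univ _) fun v _ _ => hmin0 v
  have hpos : 0 < ∑ v ∈ remaining t j, X v := Finset.sum_pos (fun v _ => hX v) ⟨_, hmem j⟩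
  have hCpos : 0 < C := by
    by_contra h
    have : C = 0 := le_antisymm (not_lt.1 h) hC0
    rw [this, zero_mul] at hsum
    linarith
  rw [div_le_div_iff₀ hCpos hpos]
  linarith

/-! ### Existence and normalization of the negations. -/

/-- Clauses without repeated variables have an admissible choice of negations. -/
theorem admissibleSigns_nonempty {n m k : ℕ} {t : Fin m → Fin k → Fin n}
    (ht : ∀ i, Function.Injective (t i)) : (admissibleSigns t).Nonempty := by
  classical
  -- `e S i` is the set of variables that clause `i` negates if its variable set is `S`. When at
  -- most `2 ^ |S|` clauses share `S`, they receive distinct subsets of `S`; otherwise coincidences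
  -- are allowed and the empty set will do.
  have hex : ∀ S : Finset (Fin n), ∃ e : Fin m → Finset (Fin n),
      (∀ i, e i ⊆ S) ∧ ((Finset.univ.filter fun l => Finset.univ.image (t l) = S).card ≤ 2 ^ S.card →
        ∀ i i', Finset.univ.image (t i) = S → Finset.univ.image (t i') = S → e i = e i' →
          i = i') := by
    intro S
    by_cases hS : (Finset.univ.filter fun l => Finset.univ.image (t l) = S).card ≤ 2 ^ S.card
    · have hcard : Fintype.card (Finset.univ.filter fun l => Finset.univ.image (t l) = S) ≤
          Fintype.card S.powerset := by
        rwa [Fintype.card_coe, Fintype.card_coe, Finset.card_powerset]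
      obtain ⟨f⟩ := Function.Embedding.nonempty_of_card_le hcard
      refine ⟨fun i => if h : i ∈ Finset.univ.filter fun l => Finset.univ.image (t l) = S then
        (f ⟨i, h⟩).1 else ∅, fun i => ?_, fun _ i i' hi hi' h => ?_⟩
      · dsimp only
        split_ifs with h
        · exact Finset.mem_powerset.1 (f ⟨i, h⟩).2
        · exact Finset.empty_subset _
      · have h1 : i ∈ Finset.univ.filter fun l => Finset.univ.image (t l) = S := by simp [hi]
        have h2 : i' ∈ Finset.univ.filter fun l => Finset.univ.image (t l) = S := by simp [hi']
        simp only [dif_pos h1, dif_pos h2] at h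
        simpa using f.injective (Subtype.ext h)
    · exact ⟨fun _ => ∅, fun _ => Finset.empty_subset _, fun h => absurd h hS⟩
  choose e he1 he2 using hex
  refine ⟨fun i j => decide (t i j ∈ e (Finset.univ.image (t i)) i), ?_⟩
  intro i i' hne heq
  have himg : ∀ l, (literals (t l)
      (fun j => decide (t l j ∈ e (Finset.univ.image (t l)) l))).image Prod.fst =
      Finset.univ.image (t l) := by
    intro l
    ext x
    simp [literals]
  have hS : Finset.univ.image (t i) = Finset.univ.image (t i') := by
    rw [← himg i, ← himg i']
    exact congrArg _ heq
  have hee : e (Finset.univ.image (t i)) i = e (Finset.univ.image (t i)) i' := by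
    -- The set of negated variables can be read off from the set of literals.
    have key : ∀ a b, Finset.univ.image (t a) = Finset.univ.image (t b) →
        literals (t a) (fun j => decide (t a j ∈ e (Finset.univ.image (t a)) a)) =
          literals (t b) (fun j => decide (t b j ∈ e (Finset.univ.image (t b)) b)) →
        e (Finset.univ.image (t a)) a ⊆ e (Finset.univ.image (t a)) b := by
      intro a b hab h x hx
      obtain ⟨j, -, rfl⟩ := Finset.mem_image.1 (he1 _ _ hx)
      have hmem : (t a j, true) ∈
          literals (t a) (fun j => decide (t a j ∈ e (Finset.univ.image (t a)) a)) :=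
        Finset.mem_image.2 ⟨j, Finset.mem_univ _, by simp [hx]⟩
      rw [h] at hmem
      obtain ⟨j', -, hj'⟩ := Finset.mem_image.1 hmem
      simp only [Prod.mk.injEq, decide_eq_true_eq] at hj'
      rw [hab, ← hj'.1]
      exact hj'.2
    refine Finset.Subset.antisymm (key i i' hS heq) ?_
    have := key i' i hS.symm heq.symm
    rwa [← hS] at this
  by_contra hle
  refine hne (he2 _ ?_ i i' rfl hS.symm hee)
  -- Injectivity gives `|S| = k`, so the number of subsets matches the threshold `2 ^ k` of
  -- admissibility.
  rw [Finset.card_image_of_injective _ (ht i), Finset.card_univ, Fintype.card_fin]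
  rw [not_lt, ← Set.ncard_coe_finset] at *
  refine le_trans (le_of_eq ?_) hle
  congr 1
  ext l
  simp [← Finset.coe_inj]

theorem sum_signProb {n m k : ℕ} {t : Fin m → Fin k → Fin n}
    (ht : ∀ i, Function.Injective (t i)) : ∑ s, signProb t s = 1 := by
  classical
  have hpos : 0 < (admissibleSigns t).ncard :=
    (Set.ncard_pos (Set.toFinite _)).2 (admissibleSigns_nonempty ht)
  unfold signProb
  simp only [Set.indicator_apply]
  rw [← Finset.sum_filter, Finset.sum_const, ← Set.ncard_coe_finset]
  simp only [Finset.coe_filter, Finset.mem_univ, true_and, Set.ofPred_mem_eq, nsmul_eq_mul]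
  have : ((admissibleSigns t).ncard : ℝ) ≠ 0 := by exact_mod_cast hpos.ne'
  field_simp

theorem signProb_nonneg {n m k : ℕ} (t : Fin m → Fin k → Fin n) (s : Fin m → Fin k → Bool) :
    0 ≤ signProb t s :=
  Set.indicator_nonneg (fun _ _ => by positivity) s

open MeasureTheory

/-! ### Second moments of sums and of off-diagonal pair sums. -/

section Variance

variable {E F : Type*} [MeasurableSpace E] [MeasurableSpace F]

/-- Orthogonality of a function of `x` and a function of `(y, x)` whose mean in `y` vanishes. -/
theorem integral_prod_add_sq (μ : Measure E) [IsProbabilityMeasure μ] (ν : Measure F)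
    [IsProbabilityMeasure ν] {S : F → ℝ} {g : E → F → ℝ} (hS : Measurable S)
    (hg : Measurable (Function.uncurry g)) {C C' : ℝ} (hSC : ∀ x, |S x| ≤ C)
    (hgC : ∀ y x, |g y x| ≤ C') (h0 : ∀ x, ∫ y, g y x ∂μ = 0) :
    ∫ z, (S z.2 + g z.1 z.2) ^ 2 ∂(μ.prod ν) =
      ∫ x, S x ^ 2 ∂ν + ∫ x, ∫ y, g y x ^ 2 ∂μ ∂ν := by
  have hgz : Measurable fun z : E × F => g z.1 z.2 := hg
  have hgx : ∀ x, Measurable fun y => g y x := fun x => hgz.comp (by fun_prop : Measurable fun y : E => (y, x))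
  have hint : Integrable (fun z : E × F => (S z.2 + g z.1 z.2) ^ 2) (μ.prod ν) := by
    refine Integrable.of_bound (by fun_prop) ((C + C') ^ 2) (Filter.Eventually.of_forall fun z => ?_)
    rw [Real.norm_eq_abs, abs_pow]
    exact pow_le_pow_left₀ (abs_nonneg _) ((abs_add_le _ _).trans (add_le_add (hSC _) (hgC _ _))) 2
  have hint2 : Integrable (fun z : E × F => g z.1 z.2 ^ 2) (μ.prod ν) := by
    refine Integrable.of_bound (by fun_prop) (C' ^ 2) (Filter.Eventually.of_forall fun z => ?_)
    rw [Real.norm_eq_abs, abs_pow]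
    exact pow_le_pow_left₀ (abs_nonneg _) (hgC _ _) 2
  have hint3 : Integrable (fun x => S x ^ 2) ν := by
    refine Integrable.of_bound (by fun_prop) (C ^ 2) (Filter.Eventually.of_forall fun z => ?_)
    rw [Real.norm_eq_abs, abs_pow]
    exact pow_le_pow_left₀ (abs_nonneg _) (hSC _) 2
  rw [integral_prod_symm _ hint, ← integral_add hint3 hint2.integral_prod_right]
  congr 1
  ext x
  have i1 : Integrable (fun y => g y x) μ :=
    Integrable.of_bound (hgx x).aestronglyMeasurable C' (Filter.Eventually.of_forall fun y => hgC y x)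
  have i2 : Integrable (fun y => g y x ^ 2) μ := by
    refine Integrable.of_bound ((hgx x).pow_const 2).aestronglyMeasurable (C' ^ 2)
      (Filter.Eventually.of_forall fun z => ?_)
    rw [Real.norm_eq_abs, abs_pow]
    exact pow_le_pow_left₀ (abs_nonneg _) (hgC _ _) 2
  -- The cross term `2 * S x * g y x` integrates to zero in `y`.
  calc ∫ y, (S x + g y x) ^ 2 ∂μ = ∫ y, (S x ^ 2 + 2 * S x * g y x) + g y x ^ 2 ∂μ := by
        congr 1; ext y; ring
    _ = S x ^ 2 + ∫ y, g y x ^ 2 ∂μ := by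
        have i3 : Integrable (fun y => S x ^ 2 + 2 * S x * g y x) μ :=
          (integrable_const _).add (i1.const_mul _)
        rw [integral_add i3 i2,
          integral_add (integrable_const _) (i1.const_mul _), integral_const_mul, h0]
        simp

theorem integral_pi_succ (μ : Measure E) [IsProbabilityMeasure μ] {n : ℕ}
    (f : (Fin (n + 1) → E) → ℝ) :
    ∫ x, f x ∂(Measure.pi fun _ => μ) =
      ∫ z, f (Fin.cons z.1 z.2) ∂(μ.prod (Measure.pi fun _ : Fin n => μ)) := by
  have h := (measurePreserving_piFinSuccAbove (fun _ : Fin (n + 1) => μ) 0).symm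
  rw [← h.integral_comp']
  congr 1
  ext z
  congr 1
  ext i
  simp [MeasurableEquiv.piFinSuccAbove, Fin.insertNthEquiv]

/-- The variance of a sum of independent identically distributed centred random variables. -/
theorem integral_pi_sum_sq (μ : Measure E) [IsProbabilityMeasure μ] {f : E → ℝ}
    (hf : Measurable f) {C : ℝ} (hC : ∀ x, |f x| ≤ C) (h0 : ∫ x, f x ∂μ = 0) (n : ℕ) :
    ∫ x, (∑ i : Fin n, f (x i)) ^ 2 ∂(Measure.pi fun _ => μ) = n * ∫ x, f x ^ 2 ∂μ := by
  induction n with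
  | zero => simp
  | succ n ih =>
    rw [integral_pi_succ]
    simp only [Fin.sum_univ_succ, Fin.cons_zero, Fin.cons_succ]
    have := integral_prod_add_sq μ (Measure.pi fun _ : Fin n => μ)
      (S := fun x => ∑ i, f (x i)) (g := fun y _ => f y) (by fun_prop) (by fun_prop)
      (C := n * C) (C' := C)
      (fun x => (Finset.abs_sum_le_sum_abs _ _).trans
        ((Finset.sum_le_sum fun i _ => hC (x i)).trans (by simp)))
      (fun y _ => hC y) (fun _ => h0)
    simp only [integral_const, probReal_univ, one_smul] at this
    simp_rw [add_comm (f _)]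
    rw [this, ih]
    push_cast
    ring

/-- Second moment of the off-diagonal sum of a symmetric kernel with vanishing means: its terms
are pairwise uncorrelated. -/
theorem integral_pi_offDiag_sq_le (μ : Measure E) [IsProbabilityMeasure μ] {κ : E → E → ℝ}
    (hκ : Measurable (Function.uncurry κ)) {C σ : ℝ} (hC : ∀ x y, |κ x y| ≤ C)
    (hsymm : ∀ x y, κ x y = κ y x) (h0 : ∀ x, ∫ y, κ y x ∂μ = 0)
    (hσ : ∀ x, ∫ y, κ y x ^ 2 ∂μ ≤ σ) (n : ℕ) :
    ∫ x, (∑ i : Fin n, ∑ j, κ (x i) (x j) - ∑ i, κ (x i) (x i)) ^ 2 ∂(Measure.pi fun _ => μ) ≤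
      4 * n ^ 2 * σ := by
  have hκ' : Measurable fun z : E × E => κ z.1 z.2 := hκ
  have hC0 : 0 ≤ C := by
    obtain ⟨x⟩ := μ.nonempty_of_neZero
    exact (abs_nonneg _).trans (hC x x)
  have hσ0 : 0 ≤ σ := by
    obtain ⟨x⟩ := μ.nonempty_of_neZero
    exact (integral_nonneg fun _ => sq_nonneg _).trans (hσ x)
  induction n with
  | zero => simp
  | succ n ih =>
    rw [integral_pi_succ]
    have hκm : ∀ i j, Measurable fun x : Fin n → E => κ (x i) (x j) := fun i j =>
      hκ'.comp (by fun_prop : Measurable fun x : Fin n → E => (x i, x j))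
    have hκm2 : ∀ i, Measurable fun z : E × (Fin n → E) => κ z.1 (z.2 i) := fun i =>
      hκ'.comp (by fun_prop : Measurable fun z : E × (Fin n → E) => (z.1, z.2 i))
    have hsq : ∀ x, Measurable fun y => κ x y := fun x =>
      hκ'.comp (by fun_prop : Measurable fun y => (x, y))
    have hsum : ∀ y (x : Fin n → E), |∑ i, κ y (x i)| ≤ n * C := fun y x =>
      (Finset.abs_sum_le_sum_abs _ _).trans
        ((Finset.sum_le_sum fun i _ => hC _ _).trans (by simp))
    have hg2 : ∀ y (x : Fin n → E), |2 * ∑ i, κ y (x i)| ≤ 2 * (n * C) := fun y x => by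
      rw [abs_mul, abs_two]; linarith [hsum y x]
    -- By symmetry a new point `y` adds `2 * ∑ i, κ y (x i)`, which has mean zero given the old
    -- points and is therefore orthogonal to the old sum.
    have heq : ∀ z : E × (Fin n → E),
        (∑ i : Fin (n + 1), ∑ j, κ ((Fin.cons z.1 z.2 : Fin (n + 1) → E) i)
            ((Fin.cons z.1 z.2 : Fin (n + 1) → E) j) -
          ∑ i, κ ((Fin.cons z.1 z.2 : Fin (n + 1) → E) i)
            ((Fin.cons z.1 z.2 : Fin (n + 1) → E) i)) =
        (∑ i, ∑ j, κ (z.2 i) (z.2 j) - ∑ i, κ (z.2 i) (z.2 i)) + 2 * ∑ i, κ z.1 (z.2 i) := by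
      intro z
      simp only [Fin.sum_univ_succ, Fin.cons_zero, Fin.cons_succ, Finset.sum_add_distrib]
      rw [Finset.sum_congr rfl fun i _ => hsymm (z.2 i) z.1]
      ring
    simp_rw [heq]
    have key := integral_prod_add_sq μ (Measure.pi fun _ : Fin n => μ)
      (S := fun x => ∑ i, ∑ j, κ (x i) (x j) - ∑ i, κ (x i) (x i))
      (g := fun y x => 2 * ∑ i, κ y (x i)) (by fun_prop)
      (by
        have : Measurable fun z : E × (Fin n → E) => 2 * ∑ i, κ z.1 (z.2 i) := by fun_prop
        exact this)
      (C := n * (n * C) + n * C) (C' := 2 * (n * C))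
      (fun x => by
        refine (abs_sub _ _).trans (add_le_add ?_ ?_)
        · exact (Finset.abs_sum_le_sum_abs _ _).trans
            ((Finset.sum_le_sum fun i _ => hsum (x i) x).trans (by simp))
        · exact (Finset.abs_sum_le_sum_abs _ _).trans
            ((Finset.sum_le_sum fun i _ => hC _ _).trans (by simp)))
      hg2
      (fun x => by
        rw [integral_const_mul, integral_finsetSum]
        · simp [h0]
        · intro i _
          exact Integrable.of_bound (hκ'.comp (by fun_prop : Measurable fun y => (y, x i))).aestronglyMeasurable C
            (Filter.Eventually.of_forall fun y => hC _ _))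
    rw [key]
    -- After exchanging the integrals, `y` is fixed and the sum over the old points is one of
    -- independent centred terms. The increment `4nσ` fits between `4n²σ` and `4(n+1)²σ`.
    have hvar : ∫ x : Fin n → E, ∫ y, (2 * ∑ i, κ y (x i)) ^ 2 ∂μ ∂(Measure.pi fun _ => μ) ≤
        4 * (n * σ) := by
      have hmeas : Measurable fun z : (Fin n → E) × E => (2 * ∑ i, κ z.2 (z.1 i)) ^ 2 := by
        have : ∀ i, Measurable fun z : (Fin n → E) × E => κ z.2 (z.1 i) := fun i =>
          hκ'.comp (by fun_prop : Measurable fun z : (Fin n → E) × E => (z.2, z.1 i))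
        fun_prop
      have hint : Integrable (fun z : (Fin n → E) × E => (2 * ∑ i, κ z.2 (z.1 i)) ^ 2)
          ((Measure.pi fun _ => μ).prod μ) := by
        refine Integrable.of_bound hmeas.aestronglyMeasurable ((2 * (n * C)) ^ 2)
          (Filter.Eventually.of_forall fun z => ?_)
        rw [Real.norm_eq_abs, abs_pow]
        exact pow_le_pow_left₀ (abs_nonneg _) (hg2 _ _) 2
      rw [integral_integral_swap hint]
      have hin : ∀ y, ∫ x : Fin n → E, (2 * ∑ i, κ y (x i)) ^ 2 ∂(Measure.pi fun _ => μ) ≤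
          4 * (n * σ) := by
        intro y
        simp_rw [mul_pow]
        rw [integral_const_mul, integral_pi_sum_sq μ (hsq y) (hC y)
          (by rw [← h0 y]; congr 1; ext z; exact hsymm _ _)]
        have : ∫ x, κ y x ^ 2 ∂μ ≤ σ := by
          refine le_trans (le_of_eq ?_) (hσ y)
          congr 1; ext z; rw [hsymm]
        have := mul_le_mul_of_nonneg_left this (Nat.cast_nonneg (α := ℝ) n)
        linarith
      refine (integral_mono hint.integral_prod_right (integrable_const _) hin).trans ?_
      simp
    have : (4 * ((n + 1 : ℕ) : ℝ) ^ 2 * σ) = 4 * n ^ 2 * σ + 8 * (n * σ) + 4 * σ := by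
      push_cast; ring
    have hn : 0 ≤ n * σ := by positivity
    linarith

end Variance

/-! ### The uniform measure on the torus and the generating function of the number of nice clauses.
-/

instance : IsProbabilityMeasure (volume : Measure UnitAddCircle) :=
  ⟨UnitAddCircle.measure_univ⟩

instance {d : ℕ} : IsProbabilityMeasure (volume : Measure (Torus d)) :=
  inferInstanceAs (IsProbabilityMeasure (Measure.pi fun _ : Fin d => volume))

/-- The sequence `t` picks in each step an available variable of the highest weight. -/
def Sorted {n k : ℕ} (X : Fin n → ℝ) (t : Fin k → Fin n) : Prop :=
  ∀ j, t j ∈ remaining t j ∧ ∀ v ∈ remaining t j, X v ≤ X (t j)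

open Classical in
/-- The expectation of `z` to the indicator of being sorted, when drawing with weights `X`. -/
noncomputable def drawExp {n : ℕ} (k : ℕ) (z : ENNReal) (X : Fin n → ℝ) : ENNReal :=
  ∑ t : Fin k → Fin n, ENNReal.ofReal (drawProb X t) * if Sorted X t then z else 1

theorem lintegral_pi_prod_eq_pow {E : Type*} [MeasurableSpace E] (μ : Measure E)
    [IsProbabilityMeasure μ] {f : E → ENNReal} (hf : Measurable f) (m : ℕ) :
    ∫⁻ x, ∏ i : Fin m, f (x i) ∂(Measure.pi fun _ => μ) = (∫⁻ x, f x ∂μ) ^ m := by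
  induction m with
  | zero => simp
  | succ m ih =>
    have h := (measurePreserving_piFinSuccAbove (fun _ : Fin (m + 1) => μ) 0).symm
    rw [← h.lintegral_comp_emb (MeasurableEquiv.measurableEmbedding _)]
    simp only [Fin.prod_univ_succ]
    have : ∀ z : E × (Fin m → E),
        f ((MeasurableEquiv.piFinSuccAbove (fun _ : Fin (m + 1) => E) 0).symm z 0) *
          ∏ i : Fin m, f ((MeasurableEquiv.piFinSuccAbove (fun _ : Fin (m + 1) => E) 0).symm z i.succ)
          = f z.1 * ∏ i : Fin m, f (z.2 i) := fun z => rfl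
    simp_rw [this]
    rw [lintegral_prod_mul (f := f) (g := fun x : Fin m → E => ∏ i, f (x i)) hf.aemeasurable
      (Finset.measurable_prod _ fun i _ => hf.comp (measurable_pi_apply i)).aemeasurable,
      ih, pow_succ']

theorem measurable_torusDist {d : ℕ} (p : ℕ∞) :
    Measurable fun z : Torus d × Torus d => torusDist p z.1 z.2 := by
  unfold torusDist
  split_ifs
  · exact Measurable.iSup fun i => by fun_prop
  · fun_prop

theorem measurable_connWeight {d : ℕ} (p : ℕ∞) (T w : ℝ) :
    Measurable fun z : Torus d × Torus d => connWeight p T w z.1 z.2 := by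
  unfold connWeight
  have := measurable_torusDist (d := d) p
  fun_prop

theorem measurable_connWeight_comp {Ω : Type*} [MeasurableSpace Ω] {n d : ℕ} (p : ℕ∞) (T : ℝ)
    (w : Fin n → ℝ) {c : Ω → Torus d} {V : Ω → Fin n → Torus d} (hc : Measurable c)
    (hV : Measurable V) : Measurable fun ω v => connWeight p T (w v) (c ω) (V ω v) := by
  rw [measurable_pi_iff]
  intro v
  have h : Measurable fun ω => (c ω, V ω v) := hc.prodMk (measurable_pi_iff.1 hV v)
  simpa only [Function.comp_def] using (measurable_connWeight p T (w v)).comp h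

theorem torusDist_nonneg {d : ℕ} (p : ℕ∞) (x y : Torus d) : 0 ≤ torusDist p x y := by
  unfold torusDist
  split_ifs
  · exact Real.iSup_nonneg fun i => norm_nonneg _
  · positivity

theorem connWeight_nonneg {d : ℕ} (p : ℕ∞) (T : ℝ) {w : ℝ} (hw : 0 ≤ w) (x y : Torus d) :
    0 ≤ connWeight p T w x y :=
  Real.rpow_nonneg (div_nonneg hw (pow_nonneg (torusDist_nonneg p x y) _)) _

theorem measurable_drawProb {Ω : Type*} [MeasurableSpace Ω] {n k : ℕ} {X : Ω → Fin n → ℝ}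
    (hX : Measurable X) (t : Fin k → Fin n) : Measurable fun ω => drawProb (X ω) t := by
  unfold drawProb
  split_ifs
  · fun_prop
  · fun_prop

theorem measurableSet_sorted {Ω : Type*} [MeasurableSpace Ω] {n k : ℕ} {X : Ω → Fin n → ℝ}
    (hX : Measurable X) (t : Fin k → Fin n) : MeasurableSet {ω | Sorted (X ω) t} := by
  unfold Sorted
  simp only [Set.ofPred_forall, Set.ofPred_and]
  refine MeasurableSet.iInter fun j => (MeasurableSet.const _).inter ?_
  refine MeasurableSet.iInter fun v => MeasurableSet.iInter fun _ => ?_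
  exact measurableSet_le (by fun_prop) (by fun_prop)

theorem measurable_drawExp {Ω : Type*} [MeasurableSpace Ω] {n : ℕ} (k : ℕ) (z : ENNReal)
    {X : Ω → Fin n → ℝ} (hX : Measurable X) : Measurable fun ω => drawExp k z (X ω) := by
  classical
  unfold drawExp
  refine Finset.measurable_sum _ fun t _ => ?_
  exact (measurable_drawProb hX t).ennreal_ofReal.mul
    (Measurable.ite (measurableSet_sorted hX t) measurable_const measurable_const)

-- Writing the power as a product over clauses lets independence factorize its expectation.
open Classical in
theorem pow_numNice {n m k d : ℕ} (p : ℕ∞) (T : ℝ) (w : Fin n → ℝ) (z : ENNReal)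
    (Φ : GeomFormula n m k d) :
    z ^ Φ.numNice p T w = ∏ i, if Sorted (Φ.X p T w i) (Φ.drawn i) then z else 1 := by
  rw [Finset.prod_ite, Finset.prod_const_one, mul_one, Finset.prod_const,
    GeomFormula.numNice, ← Set.ncard_coe_finset]
  congr 2
  ext i
  simp only [Finset.coe_filter, Finset.mem_univ, true_and]
  rfl

theorem measurable_pow_numNice {n m k d : ℕ} (p : ℕ∞) (T : ℝ) (w : Fin n → ℝ) (z : ENNReal) :
    Measurable fun Φ : GeomFormula n m k d => z ^ Φ.numNice p T w := by
  classical
  have hXm : ∀ i : Fin m, Measurable fun P : (Fin n → Torus d) × (Fin m → Torus d) =>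
      fun v => connWeight p T (w v) (P.2 i) (P.1 v) := fun i =>
    measurable_connWeight_comp p T w ((measurable_pi_apply i).comp measurable_snd) measurable_fst
  simp_rw [pow_numNice]
  refine measurable_from_prod_countable_left fun y => ?_
  exact Finset.measurable_prod _ fun i _ =>
    Measurable.ite (measurableSet_sorted (hXm i) (y.1 i)) measurable_const measurable_const

/-- Niceness ignores the negations, so these sum out to `1`. Where a clause repeats a variable, the
total mass of the negations is not known to be `1`, but the drawing probability vanishes there. -/
theorem sum_draw_sign {n m k : ℕ} (X : Fin m → Fin n → ℝ) (hX : ∀ i v, 0 ≤ X i v)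
    (f : (Fin m → Fin k → Fin n) → ENNReal) :
    ∑ y : (Fin m → Fin k → Fin n) × (Fin m → Fin k → Bool),
        ENNReal.ofReal ((∏ i, drawProb (X i) (y.1 i)) * signProb y.1 y.2) * f y.1 =
      ∑ t : Fin m → Fin k → Fin n, (∏ i, ENNReal.ofReal (drawProb (X i) (t i))) * f t := by
  rw [Fintype.sum_prod_type]
  refine Finset.sum_congr rfl fun t _ => ?_
  have h0 : ∀ i, 0 ≤ drawProb (X i) (t i) := fun i => drawProb_nonneg (hX i) _
  simp only [ENNReal.ofReal_mul (Finset.prod_nonneg fun i _ => h0 i)]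
  rw [← Finset.sum_mul, ← Finset.mul_sum,
    ← ENNReal.ofReal_sum_of_nonneg fun s _ => signProb_nonneg t s]
  by_cases ht : ∀ i, Function.Injective (t i)
  · rw [sum_signProb ht, ENNReal.ofReal_one, mul_one, ENNReal.ofReal_prod_of_nonneg fun i _ => h0 i]
  · push Not at ht
    obtain ⟨i, hi⟩ := ht
    have : drawProb (X i) (t i) = 0 := by rw [drawProb, if_neg hi]
    rw [Finset.prod_eq_zero (Finset.mem_univ i) this,
      Finset.prod_eq_zero (Finset.mem_univ i) (by rw [this, ENNReal.ofReal_zero])]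
    simp

/-- Given the positions of the variables, the clauses are independent and identically
distributed. -/
theorem lintegral_geometricModel {n m k d : ℕ} (p : ℕ∞) (T : ℝ) {w : Fin n → ℝ}
    (hw : ∀ v, 1 ≤ w v) (z : ENNReal) {G : (Fin n → Torus d) → ENNReal} (hG : Measurable G) :
    ∫⁻ Φ, G Φ.varPos * z ^ Φ.numNice p T w ∂(geometricModel n m k d p T w) =
      ∫⁻ V, G V * (∫⁻ c, drawExp k z (fun v => connWeight p T (w v) c (V v))) ^ m := by
  classical
  have hXm : ∀ i : Fin m, Measurable fun P : (Fin n → Torus d) × (Fin m → Torus d) =>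
      fun v => connWeight p T (w v) (P.2 i) (P.1 v) := fun i =>
    measurable_connWeight_comp p T w ((measurable_pi_apply i).comp measurable_snd) measurable_fst
  have hX0 : ∀ (P : (Fin n → Torus d) × (Fin m → Torus d)) i v,
      0 ≤ connWeight p T (w v) (P.2 i) (P.1 v) := fun P i v =>
    connWeight_nonneg p T (zero_le_one.trans (hw v)) _ _
  have hdens : Measurable fun Φ : GeomFormula n m k d =>
      ENNReal.ofReal ((∏ i, drawProb (Φ.X p T w i) (Φ.drawn i)) * signProb Φ.drawn Φ.negated) := by
    refine measurable_from_prod_countable_left fun y => ?_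
    have : Measurable fun P : (Fin n → Torus d) × (Fin m → Torus d) =>
        ∏ i, drawProb (fun v => connWeight p T (w v) (P.2 i) (P.1 v)) (y.1 i) :=
      Finset.measurable_prod _ fun i _ => measurable_drawProb (hXm i) (y.1 i)
    exact (this.mul_const (signProb y.1 y.2)).ennreal_ofReal
  have hF : Measurable fun Φ : GeomFormula n m k d => G Φ.varPos * z ^ Φ.numNice p T w :=
    (hG.comp (measurable_fst.comp measurable_fst)).mul (measurable_pow_numNice p T w z)
  unfold geometricModel
  rw [lintegral_withDensity_eq_lintegral_mul _ hdens hF,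
    lintegral_prod _ (hdens.mul hF).aemeasurable]
  -- For fixed positions, the sum over all draws of a product over clauses is a product of
  -- one-clause sums.
  have hin : ∀ P : (Fin n → Torus d) × (Fin m → Torus d),
      ∫⁻ y, ((fun Φ : GeomFormula n m k d =>
        ENNReal.ofReal ((∏ i, drawProb (Φ.X p T w i) (Φ.drawn i)) * signProb Φ.drawn Φ.negated)) *
          fun Φ : GeomFormula n m k d => G Φ.varPos * z ^ Φ.numNice p T w) (P, y) ∂Measure.count =
        G P.1 * ∏ i, drawExp k z (fun v => connWeight p T (w v) (P.2 i) (P.1 v)) := by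
    intro P
    rw [lintegral_count, tsum_fintype]
    simp only [Pi.mul_apply, pow_numNice]
    have := sum_draw_sign (k := k) (fun i v => connWeight p T (w v) (P.2 i) (P.1 v)) (hX0 P)
      (fun t => G P.1 * ∏ i,
        if Sorted (fun v => connWeight p T (w v) (P.2 i) (P.1 v)) (t i) then z else 1)
    refine this.trans ?_
    simp only [drawExp]
    rw [Finset.prod_univ_sum, Fintype.piFinset_univ, Finset.mul_sum]
    refine Finset.sum_congr rfl fun t _ => ?_
    rw [Finset.prod_mul_distrib]
    ring
  simp_rw [hin]
  have hE' : Measurable fun P : (Fin n → Torus d) × (Fin m → Torus d) =>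
      G P.1 * ∏ i, drawExp k z (fun v => connWeight p T (w v) (P.2 i) (P.1 v)) := by
    refine (hG.comp measurable_fst).mul (Finset.measurable_prod _ fun i _ => ?_)
    exact measurable_drawExp k z (hXm i)
  -- With `V` fixed, the clause positions are independent and enter one factor each, which yields
  -- the `m`-th power.
  rw [Measure.volume_eq_prod, lintegral_prod _ hE'.aemeasurable]
  refine lintegral_congr fun V => ?_
  have hV : Measurable fun c => drawExp k z (fun v => connWeight p T (w v) c (V v)) :=
    measurable_drawExp k z (measurable_connWeight_comp p T w measurable_id measurable_const)
  have hprod : Measurable fun C : Fin m → Torus d =>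
      ∏ i, drawExp k z (fun v => connWeight p T (w v) (C i) (V v)) :=
    Finset.measurable_prod _ fun i _ => hV.comp (measurable_pi_apply i)
  exact (lintegral_const_mul _ hprod).trans
    (congrArg (G V * ·) (lintegral_pi_prod_eq_pow volume hV m))

/-! ### Comparison with the sup metric and tails of connection weights. -/

/-- `dist` on `Torus d` is the sup metric, whose balls are cubes of explicit volume. Together with
`torusDist_le_mul_dist` this removes `p` from the argument at the cost of constants depending on
`d`. -/
theorem dist_le_torusDist {d : ℕ} {p : ℕ∞} (hp : 1 ≤ p) (x y : Torus d) :
    dist x y ≤ torusDist p x y := by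
  refine (dist_pi_le_iff (torusDist_nonneg p x y)).2 fun i => ?_
  rw [dist_eq_norm]
  unfold torusDist
  split_ifs with h
  · exact le_ciSup (f := fun i => ‖x i - y i‖) (Set.finite_range _).bddAbove i
  · have hq : 1 ≤ p.toNat := by
      lift p to ℕ using h
      exact_mod_cast hp
    have hq0 : (p.toNat : ℝ) ≠ 0 := by positivity
    calc ‖x i - y i‖ = (‖x i - y i‖ ^ p.toNat) ^ (1 / (p.toNat : ℝ)) := by
          rw [← Real.rpow_natCast, ← Real.rpow_mul (norm_nonneg _), mul_one_div_cancel hq0,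
            Real.rpow_one]
      _ ≤ _ := by
          refine Real.rpow_le_rpow (by positivity) ?_ (by positivity)
          exact Finset.single_le_sum (f := fun i => ‖x i - y i‖ ^ p.toNat)
            (fun i _ => by positivity) (Finset.mem_univ i)

theorem torusDist_le_mul_dist {d : ℕ} (hd : 1 ≤ d) {p : ℕ∞} (hp : 1 ≤ p) (x y : Torus d) :
    torusDist p x y ≤ d * dist x y := by
  have hd1 : (1 : ℝ) ≤ d := by exact_mod_cast hd
  have hle : ∀ i, ‖x i - y i‖ ≤ dist x y := fun i => by
    rw [← dist_eq_norm]; exact dist_le_pi_dist x y i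
  unfold torusDist
  split_ifs with h
  · have : Nonempty (Fin d) := ⟨⟨0, hd⟩⟩
    exact ciSup_le fun i => (hle i).trans (le_mul_of_one_le_left dist_nonneg hd1)
  · have hq : 1 ≤ p.toNat := by
      lift p to ℕ using h
      exact_mod_cast hp
    have hq0 : (p.toNat : ℝ) ≠ 0 := by positivity
    calc (∑ i, ‖x i - y i‖ ^ p.toNat) ^ (1 / (p.toNat : ℝ))
        ≤ ((d * dist x y) ^ p.toNat) ^ (1 / (p.toNat : ℝ)) := by
          refine Real.rpow_le_rpow (by positivity) ?_ (by positivity)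
          calc ∑ i, ‖x i - y i‖ ^ p.toNat ≤ ∑ _i : Fin d, dist x y ^ p.toNat :=
                Finset.sum_le_sum fun i _ => pow_le_pow_left₀ (norm_nonneg _) (hle i) _
            _ = d * dist x y ^ p.toNat := by simp
            -- The crude bound `d ≤ d ^ q` gives a factor `d` in place of `d ^ (1 / q)`, so that one
            -- constant serves all norms.
            _ ≤ d ^ p.toNat * dist x y ^ p.toNat :=
                mul_le_mul_of_nonneg_right (le_self_pow₀ hd1 (by omega)) (by positivity)
            _ = _ := (mul_pow _ _ _).symm
      _ = d * dist x y := by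
          rw [← Real.rpow_natCast, ← Real.rpow_mul (by positivity), mul_one_div_cancel hq0,
            Real.rpow_one]

theorem volume_torus_closedBall {d : ℕ} (x : Torus d) {r : ℝ} (hr : 0 ≤ r) :
    volume (Metric.closedBall x r) = ENNReal.ofReal (min 1 (2 * r) ^ d) := by
  rw [volume_pi_closedBall _ hr, ENNReal.ofReal_pow (by positivity)]
  simp only [AddCircle.volume_closedBall, Finset.prod_const, Finset.card_univ, Fintype.card_fin]

theorem volume_real_torus_closedBall {d : ℕ} (x : Torus d) {r : ℝ} (hr : 0 ≤ r) :
    volume.real (Metric.closedBall x r) = min 1 (2 * r) ^ d := by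
  rw [Measure.real, volume_torus_closedBall x hr, ENNReal.toReal_ofReal (by positivity)]

/-- The positions have to differ: at distance `0` the convention for division by zero makes the
connection weight `0` instead of infinite. -/
theorem le_connWeight {d : ℕ} (hd : 1 ≤ d) {p : ℕ∞} (hp : 1 ≤ p) {T : ℝ} (hT0 : 0 < T) {w : ℝ}
    (hw : 1 ≤ w) {ρ : ℝ} {c v : Torus d} (hne : c ≠ v) (h : dist c v ≤ ρ) :
    (1 / (d * ρ) ^ d) ^ (1 / T) ≤ connWeight p T w c v := by
  have h1 : 0 < torusDist p c v := (dist_pos.2 hne).trans_le (dist_le_torusDist hp c v)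
  have h2 : torusDist p c v ≤ d * ρ := (torusDist_le_mul_dist hd hp c v).trans
    (mul_le_mul_of_nonneg_left h (Nat.cast_nonneg d))
  have h3 : 0 < (d : ℝ) * ρ := h1.trans_le h2
  unfold connWeight
  refine Real.rpow_le_rpow (by positivity) ?_ (by positivity)
  exact div_le_div₀ (by linarith) hw (by positivity) (pow_le_pow_left₀ h1.le h2 d)

theorem connWeight_pos {d : ℕ} {p : ℕ∞} (hp : 1 ≤ p) {T : ℝ} {w : ℝ}
    (hw : 1 ≤ w) {c v : Torus d} (hne : c ≠ v) : 0 < connWeight p T w c v := by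
  have h1 : 0 < torusDist p c v := (dist_pos.2 hne).trans_le (dist_le_torusDist hp c v)
  unfold connWeight
  exact Real.rpow_pos_of_pos (div_pos (by linarith) (pow_pos h1 d)) _

/-- Exceeding level `y` after normalization forces `torusDist ^ d < w * R * y ^ (-T)`, which
confines `c` to a cube around `v` of volume at most `2 ^ d` times the right-hand side. The
normalizing weight is the bound of `le_connWeight` with `R = (d * ρ) ^ d`. -/
theorem volume_lt_connWeight_le {d : ℕ} (hd : 1 ≤ d) {p : ℕ∞} (hp : 1 ≤ p) {T : ℝ} (hT0 : 0 < T)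
    {w R y : ℝ} (hw : 0 < w) (hR : 0 < R) (hy : 0 < y) (v : Torus d) :
    volume {c | y < connWeight p T w c v / (1 / R) ^ (1 / T)} ≤
      ENNReal.ofReal (2 ^ d * w * R * y ^ (-T)) := by
  set s : ℝ := (w * R * y ^ (-T)) ^ (1 / (d : ℝ)) with hs
  have hA : 0 < w * R * y ^ (-T) := by positivity
  have hs0 : 0 ≤ s := by positivity
  have hsd : s ^ d = w * R * y ^ (-T) := by
    rw [hs, ← Real.rpow_natCast, ← Real.rpow_mul hA.le, one_div_mul_cancel (by positivity),
      Real.rpow_one]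
  have hsub : {c | y < connWeight p T w c v / (1 / R) ^ (1 / T)} ⊆ Metric.closedBall v s := by
    intro c hc
    simp only [Set.mem_ofPred_eq] at hc
    rw [Metric.mem_closedBall]
    refine (dist_le_torusDist hp c v).trans ?_
    have hD0 := torusDist_nonneg p c v
    rcases hD0.eq_or_lt with h0 | hpos
    · rw [← h0]; exact hs0
    refine le_of_pow_le_pow_left₀ (by omega : d ≠ 0) hs0 ?_
    rw [hsd]
    have h1 : connWeight p T w c v / (1 / R) ^ (1 / T) =
        (w * R / torusDist p c v ^ d) ^ (1 / T) := by
      unfold connWeight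
      rw [← Real.div_rpow (by positivity) (by positivity)]
      congr 1
      field_simp
    rw [h1] at hc
    have h2 : y ^ T < w * R / torusDist p c v ^ d := by
      have := Real.rpow_lt_rpow hy.le hc hT0
      rwa [← Real.rpow_mul (by positivity), one_div_mul_cancel hT0.ne', Real.rpow_one] at this
    rw [lt_div_iff₀ (by positivity)] at h2
    rw [Real.rpow_neg hy.le, ← div_eq_mul_inv, le_div_iff₀ (by positivity)]
    linarith
  refine (measure_mono hsub).trans ?_
  rw [volume_torus_closedBall v hs0]
  refine ENNReal.ofReal_le_ofReal ?_
  calc min 1 (2 * s) ^ d ≤ (2 * s) ^ d :=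
        pow_le_pow_left₀ (by positivity) (min_le_right _ _) d
    _ = _ := by rw [mul_pow, hsd]; ring

/-- Since `T < 1`, the truncated connection weight to a fixed variable has small expectation. -/
theorem lintegral_min_connWeight_le {d : ℕ} (hd : 1 ≤ d) {p : ℕ∞} (hp : 1 ≤ p) {T : ℝ}
    (hT0 : 0 < T) (hT1 : T < 1) {w R : ℝ} (hw : 0 < w) (hR : 0 < R) (v : Torus d) :
    ∫⁻ c, ENNReal.ofReal (min (connWeight p T w c v / (1 / R) ^ (1 / T)) 1) ≤
      ENNReal.ofReal (2 ^ d * w * R / (1 - T)) := by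
  have hm : Measurable fun c => connWeight p T w c v := by
    have h : Measurable fun c : Torus d => (c, v) := by fun_prop
    simpa only [Function.comp_def] using (measurable_connWeight p T w).comp h
  have h0 : ∀ c, 0 ≤ min (connWeight p T w c v / (1 / R) ^ (1 / T)) 1 := fun c =>
    le_min (div_nonneg (connWeight_nonneg p T hw.le _ _) (by positivity)) zero_le_one
  -- Layer-cake formula. Truncation removes the levels above `1`, and below `1` the tail `y ^ (-T)`
  -- has integral `1 / (1 - T)`.
  rw [lintegral_eq_lintegral_meas_lt _ (Filter.Eventually.of_forall h0)
    ((hm.div_const _).min measurable_const).aemeasurable]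
  have hint : IntervalIntegrable (fun y : ℝ => y ^ (-T)) volume 0 1 :=
    intervalIntegral.intervalIntegrable_rpow' (by linarith)
  have hint' : IntegrableOn (fun y : ℝ => 2 ^ d * w * R * y ^ (-T)) (Set.Ioc 0 1) :=
    ((intervalIntegrable_iff_integrableOn_Ioc_of_le zero_le_one).1 hint).const_mul _
  calc ∫⁻ y in Set.Ioi 0, volume {c | y < min (connWeight p T w c v / (1 / R) ^ (1 / T)) 1}
      ≤ ∫⁻ y in Set.Ioi 0, (Set.Ioc (0 : ℝ) 1).indicator
          (fun y => ENNReal.ofReal (2 ^ d * w * R * y ^ (-T))) y := by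
        refine setLIntegral_mono' measurableSet_Ioi fun y hy => ?_
        by_cases h1 : y ≤ 1
        · rw [Set.indicator_of_mem (show y ∈ Set.Ioc 0 1 from ⟨hy, h1⟩)]
          refine (measure_mono fun c hc => ?_).trans
            (volume_lt_connWeight_le hd hp hT0 hw hR hy v)
          simp only [Set.mem_ofPred_eq, lt_min_iff] at hc
          exact hc.1
        · have : {c | y < min (connWeight p T w c v / (1 / R) ^ (1 / T)) 1} = ∅ := by
            ext c
            simp only [Set.mem_ofPred_eq, lt_min_iff, Set.mem_empty_iff_false, iff_false]
            intro h
            exact h1 h.2.le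
          rw [this, measure_empty]
          exact zero_le
    _ = ∫⁻ y in Set.Ioc 0 1, ENNReal.ofReal (2 ^ d * w * R * y ^ (-T)) := by
        rw [setLIntegral_indicator measurableSet_Ioc]
        congr 2
        exact Set.inter_eq_left.2 fun y hy => hy.1
    _ = ENNReal.ofReal (∫ y in Set.Ioc 0 1, 2 ^ d * w * R * y ^ (-T)) := by
        rw [ofReal_integral_eq_lintegral_ofReal hint']
        refine (ae_restrict_mem measurableSet_Ioc).mono fun y hy => ?_
        have := hy.1
        simp only [Pi.zero_apply]
        positivity
    _ ≤ _ := by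
        rw [integral_const_mul, ← intervalIntegral.integral_of_le zero_le_one,
          integral_rpow (Or.inl (by linarith)), Real.one_rpow, Real.zero_rpow (by linarith)]
        refine ENNReal.ofReal_le_ofReal (le_of_eq ?_)
        rw [show -T + 1 = 1 - T by ring]
        ring

/-! ### The generating function of a single clause. -/

/-- Discards the null set on which a connection weight is `0` by convention; elsewhere all weights
are positive and the drawing probabilities are normalized. -/
theorem ae_ne_positions {n d : ℕ} (hd : 1 ≤ d) (V : Fin n → Torus d) :
    ∀ᵐ c : Torus d, ∀ v, c ≠ V v := by
  refine ae_all_iff.2 fun v => ?_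
  rw [ae_iff]
  simp only [ne_eq, not_not, Set.ofPred_eq_eq_singleton]
  have h := volume_torus_closedBall (V v) le_rfl
  rw [Metric.closedBall_zero] at h
  rw [h]
  simp [show d ≠ 0 by omega]

theorem drawExp_one {n k : ℕ} (hk : k ≤ n) {X : Fin n → ℝ} (hX : ∀ v, 0 < X v) :
    drawExp k 1 X = 1 := by
  simp only [drawExp, ite_self, mul_one]
  rw [← ENNReal.ofReal_sum_of_nonneg fun t _ => drawProb_nonneg (fun v => (hX v).le) t,
    sum_drawProb hk hX, ENNReal.ofReal_one]

theorem drawExp_le_one {n k : ℕ} (hk : k ≤ n) {X : Fin n → ℝ} (hX : ∀ v, 0 < X v) {z : ENNReal}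
    (hz : z ≤ 1) : drawExp k z X ≤ 1 := by
  classical
  rw [← drawExp_one hk hX]
  unfold drawExp
  gcongr with t
  split_ifs
  · exact hz
  · exact le_rfl

/-- Only the sequence `t` is exploited: its mass of at least `g` is weighted by `ζ`, and all other
mass by at most `1`. -/
theorem drawExp_le_of_sorted {n k : ℕ} (hk : k ≤ n) {X : Fin n → ℝ} (hX : ∀ v, 0 < X v) {ζ g : ℝ}
    (hζ0 : 0 ≤ ζ) (hζ1 : ζ ≤ 1) {t : Fin k → Fin n} (ht : Sorted X t) (hg : g ≤ drawProb X t) :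
    drawExp k (ENNReal.ofReal ζ) X ≤ ENNReal.ofReal (1 - (1 - ζ) * g) := by
  classical
  have h0 : ∀ t : Fin k → Fin n, 0 ≤ drawProb X t := drawProb_nonneg fun v => (hX v).le
  have heq : drawExp k (ENNReal.ofReal ζ) X =
      ENNReal.ofReal (∑ t : Fin k → Fin n, drawProb X t * if Sorted X t then ζ else 1) := by
    rw [ENNReal.ofReal_sum_of_nonneg
      fun t _ => mul_nonneg (h0 t) (by split_ifs <;> linarith)]
    unfold drawExp
    refine Finset.sum_congr rfl fun t _ => ?_
    rw [ENNReal.ofReal_mul (h0 t)]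
    split_ifs <;> simp
  rw [heq]
  refine ENNReal.ofReal_le_ofReal ?_
  have hle : ∑ t' : Fin k → Fin n, drawProb X t' * (if Sorted X t' then ζ else 1) ≤
      ∑ t' : Fin k → Fin n, (drawProb X t' - if t' = t then (1 - ζ) * g else 0) := by
    refine Finset.sum_le_sum fun t' _ => ?_
    by_cases h : t' = t
    · subst h
      rw [if_pos ht, if_pos rfl]
      nlinarith
    · rw [if_neg h, sub_zero]
      refine mul_le_of_le_one_right (h0 t') ?_
      split_ifs <;> linarith
  refine hle.trans (le_of_eq ?_)
  rw [Finset.sum_sub_distrib, sum_drawProb hk hX, Finset.sum_ite_eq' Finset.univ t]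
  simp

/-! ### Close pairs of variables and the number of variables near a clause. -/

/-- Few pairs of independent points satisfy a rare symmetric relation. -/
theorem measureReal_lt_sum_sum_le {E : Type*} [MeasurableSpace E] (μ : Measure E)
    [IsProbabilityMeasure μ] {I : E → E → ℝ} (hIm : Measurable (Function.uncurry I))
    (hI : ∀ y x, I y x = 0 ∨ I y x = 1) (hsymm : ∀ y x, I y x = I x y) {b : ℝ}
    (hb : ∀ x, ∫ y, I y x ∂μ = b) {n : ℕ} (hn : 0 < n) :
    (Measure.pi fun _ => μ).real {x : Fin n → E | 2 * n + n ^ 2 * b < ∑ u, ∑ v, I (x u) (x v)} ≤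
      4 * b := by
  have hI0 : ∀ y x, 0 ≤ I y x := fun y x => by rcases hI y x with h | h <;> rw [h]; norm_num
  have hI1 : ∀ y x, I y x ≤ 1 := fun y x => by rcases hI y x with h | h <;> rw [h]; norm_num
  have hIi : ∀ x, Integrable (fun y => I y x) μ := fun x => by
    have : Measurable fun y => I y x := hIm.comp (by fun_prop : Measurable fun y : E => (y, x))
    refine Integrable.of_bound this.aestronglyMeasurable 1 (Filter.Eventually.of_forall fun y => ?_)
    rw [Real.norm_eq_abs, abs_of_nonneg (hI0 y x)]
    exact hI1 y x
  obtain ⟨x₀⟩ := μ.nonempty_of_neZero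
  have hb0 : 0 ≤ b := hb x₀ ▸ integral_nonneg fun y => hI0 y x₀
  have hb1 : b ≤ 1 := by
    rw [← hb x₀]
    exact (integral_mono (hIi x₀) (integrable_const 1) fun y => hI1 y x₀).trans (by simp)
  have h0 : ∀ x, ∫ y, (I y x - b) ∂μ = 0 := fun x => by
    rw [integral_sub (hIi x) (integrable_const _), hb]
    simp
  -- The variance of an indicator with mean `b` is `b * (1 - b)`.
  have hsq : ∀ x, ∫ y, (I y x - b) ^ 2 ∂μ ≤ b := fun x => by
    have : ∀ y, (I y x - b) ^ 2 = (1 - 2 * b) * I y x + b ^ 2 := fun y => by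
      rcases hI y x with h | h <;> rw [h] <;> ring
    simp_rw [this]
    rw [integral_add ((hIi x).const_mul _) (integrable_const _), integral_const_mul, hb]
    simp only [integral_const, probReal_univ, smul_eq_mul, one_mul]
    nlinarith
  have hbd : ∀ y x, |I y x - b| ≤ 1 := fun y x => by
    rw [abs_le]
    constructor <;> linarith [hI0 y x, hI1 y x]
  have hκm : Measurable (Function.uncurry fun y x => I y x - b) := hIm.sub_const b
  have key := integral_pi_offDiag_sq_le μ hκm hbd (fun y x => by rw [hsymm]) h0 hsq n
  set S : (Fin n → E) → ℝ :=
    fun V => ∑ i, ∑ j, (I (V i) (V j) - b) - ∑ i, (I (V i) (V i) - b) with hS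
  have hn' : (0 : ℝ) < n := by exact_mod_cast hn
  have hSm : Measurable S := by
    have : ∀ i j, Measurable fun V : Fin n → E => I (V i) (V j) - b := fun i j =>
      hκm.comp (by fun_prop : Measurable fun V : Fin n → E => (V i, V j))
    exact (Finset.measurable_sum _ fun i _ => Finset.measurable_sum _ fun j _ => this i j).sub
      (Finset.measurable_sum _ fun i _ => this i i)
  have hSb : ∀ V, |S V| ≤ n * n + n := fun V => by
    refine (abs_sub _ _).trans (add_le_add ?_ ?_)
    · exact (Finset.abs_sum_le_sum_abs _ _).trans ((Finset.sum_le_sum fun i _ =>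
        (Finset.abs_sum_le_sum_abs _ _).trans
          (Finset.sum_le_sum fun j _ => hbd _ _)).trans (by simp))
    · exact (Finset.abs_sum_le_sum_abs _ _).trans
        ((Finset.sum_le_sum fun i _ => hbd _ _).trans (by simp))
  have hSi : Integrable (fun V => S V ^ 2) (Measure.pi fun _ => μ) := by
    refine Integrable.of_bound (hSm.pow_const 2).aestronglyMeasurable ((n * n + n) ^ 2)
      (Filter.Eventually.of_forall fun c => ?_)
    rw [Real.norm_eq_abs, abs_pow]
    exact pow_le_pow_left₀ (abs_nonneg _) (hSb c) 2
  -- The centred diagonal contributes at most `n`, so an excess of `2 * n` over `n ^ 2 * b` forces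
  -- `S ≥ n`. Chebyshev's inequality against the second moment `4 * n ^ 2 * b` then leaves `4 * b`.
  have hsub : {x : Fin n → E | 2 * n + n ^ 2 * b < ∑ u, ∑ v, I (x u) (x v)} ⊆
      {V | (n : ℝ) ^ 2 ≤ S V ^ 2} := by
    intro V hV
    simp only [Set.mem_ofPred_eq] at hV ⊢
    have h1 : S V = ∑ u, ∑ v, I (V u) (V v) - n ^ 2 * b - ∑ i, (I (V i) (V i) - b) := by
      simp only [hS, Finset.sum_sub_distrib, Finset.sum_const, Finset.card_univ, Fintype.card_fin,
        nsmul_eq_mul]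
      ring
    have h2 : ∑ i, (I (V i) (V i) - b) ≤ n :=
      (Finset.sum_le_sum fun i _ => (le_abs_self _).trans (hbd _ _)).trans (by simp)
    exact pow_le_pow_left₀ hn'.le (by linarith) 2
  have hmark := mul_meas_ge_le_integral_of_nonneg
    (Filter.Eventually.of_forall fun V => sq_nonneg (S V)) hSi ((n : ℝ) ^ 2)
  refine (measureReal_mono hsub).trans (le_of_mul_le_mul_left (?_ : (n : ℝ) ^ 2 * _ ≤ _)
    (by positivity : (0 : ℝ) < n ^ 2))
  refine (hmark.trans key).trans (le_of_eq ?_)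
  ring

section Balls

variable {n d : ℕ}

/-- The number of points of `V` that have distance at most `ρ` from `c`. -/
noncomputable def ballCount (ρ : ℝ) (V : Fin n → Torus d) (c : Torus d) : ℝ :=
  ∑ v, (Metric.closedBall (V v) ρ).indicator (fun _ => (1 : ℝ)) c

open Classical in
theorem ballCount_eq_card (ρ : ℝ) (V : Fin n → Torus d) (c : Torus d) :
    ballCount ρ V c = (Finset.univ.filter fun v => dist c (V v) ≤ ρ).card := by
  unfold ballCount
  simp only [Set.indicator_apply, Metric.mem_closedBall]
  rw [Finset.sum_boole]

theorem measurable_ballCount (ρ : ℝ) (V : Fin n → Torus d) : Measurable (ballCount ρ V) :=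
  Finset.measurable_sum _ fun _ _ =>
    measurable_const.indicator Metric.isClosed_closedBall.measurableSet

/-- The number of pairs of points of `V` that have distance at most `r`. -/
noncomputable def closePairs (r : ℝ) (V : Fin n → Torus d) : ℝ :=
  ∑ u, ∑ v, (Metric.closedBall (V v) r).indicator (fun _ => (1 : ℝ)) (V u)

theorem integrable_indicator_ball (ρ : ℝ) (x : Torus d) :
    Integrable ((Metric.closedBall x ρ).indicator fun _ => (1 : ℝ)) :=
  (integrable_const 1).indicator Metric.isClosed_closedBall.measurableSet

theorem integral_ballCount {ρ : ℝ} (hρ : 0 ≤ ρ) (V : Fin n → Torus d) :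
    ∫ c, ballCount ρ V c = n * min 1 (2 * ρ) ^ d := by
  unfold ballCount
  rw [integral_finsetSum _ fun v _ => integrable_indicator_ball ρ (V v)]
  simp only [integral_indicator_const _ Metric.isClosed_closedBall.measurableSet,
    volume_real_torus_closedBall _ hρ]
  simp

/-- The square counts ordered pairs of balls containing `c`. Two balls of radius `ρ` meet only if
their centres are within `2 * ρ`, and their intersection is no larger than one ball. -/
theorem integral_ballCount_sq_le {ρ : ℝ} (hρ : 0 ≤ ρ) (V : Fin n → Torus d) :
    ∫ c, ballCount ρ V c ^ 2 ≤ min 1 (2 * ρ) ^ d * closePairs (2 * ρ) V := by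
  have hB : ∀ x : Torus d, MeasurableSet (Metric.closedBall x ρ) := fun x =>
    Metric.isClosed_closedBall.measurableSet
  have h1 : ∀ c, ballCount ρ V c ^ 2 = ∑ u, ∑ v,
      (Metric.closedBall (V u) ρ ∩ Metric.closedBall (V v) ρ).indicator (fun _ => (1 : ℝ)) c := by
    intro c
    unfold ballCount
    rw [sq, Finset.sum_mul_sum]
    refine Finset.sum_congr rfl fun u _ => Finset.sum_congr rfl fun v _ => ?_
    classical
    simp only [Set.indicator_apply, Set.mem_inter_iff]
    split_ifs <;> simp_all
  have hi : ∀ u v, Integrable ((Metric.closedBall (V u) ρ ∩ Metric.closedBall (V v) ρ).indicator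
      fun _ => (1 : ℝ)) := fun u v => (integrable_const 1).indicator ((hB _).inter (hB _))
  simp_rw [h1]
  rw [integral_finsetSum _ fun u _ => integrable_finsetSum _ fun v _ => hi u v]
  unfold closePairs
  rw [Finset.mul_sum]
  refine Finset.sum_le_sum fun u _ => ?_
  rw [integral_finsetSum _ fun v _ => hi u v, Finset.mul_sum]
  refine Finset.sum_le_sum fun v _ => ?_
  rw [integral_indicator_const _ ((hB _).inter (hB _)), smul_eq_mul, mul_one]
  by_cases h : dist (V u) (V v) ≤ 2 * ρ
  · rw [Set.indicator_of_mem (Metric.mem_closedBall.2 h), mul_one,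
      ← volume_real_torus_closedBall (V u) hρ]
    exact measureReal_mono Set.inter_subset_left
  · rw [Set.indicator_of_notMem (fun h' => h (Metric.mem_closedBall.1 h')), mul_zero]
    have : Metric.closedBall (V u) ρ ∩ Metric.closedBall (V v) ρ = ∅ := by
      ext c
      simp only [Set.mem_inter_iff, Metric.mem_closedBall, Set.mem_empty_iff_false, iff_false]
      rintro ⟨h1, h2⟩
      have := dist_triangle_left (V u) (V v) c
      exact h (by linarith)
    rw [this, measureReal_empty]

/-- If the count has mean at least `k` and bounded second moment, it is at least `k` with
probability bounded from below. -/
theorem le_volume_ballCount {k : ℕ} (hk : 1 ≤ k) {ρ Q : ℝ} (hQ : 0 < Q) (V : Fin n → Torus d)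
    (h1 : k ≤ ∫ c, ballCount ρ V c) (h2 : ∫ c, ballCount ρ V c ^ 2 ≤ Q) :
    1 / (4 * Q) ≤ volume.real {c | (k : ℝ) ≤ ballCount ρ V c} := by
  have hm := measurable_ballCount ρ V
  have hN : ∀ c, |ballCount ρ V c| ≤ n := fun c => by
    classical
    rw [ballCount_eq_card, Nat.abs_cast]
    exact_mod_cast (Finset.card_le_univ _).trans (by simp)
  have i1 : Integrable (ballCount ρ V) :=
    Integrable.of_bound hm.aestronglyMeasurable n (Filter.Eventually.of_forall hN)
  have i2 : Integrable (fun c => ballCount ρ V c ^ 2) := by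
    refine Integrable.of_bound (hm.pow_const 2).aestronglyMeasurable (n ^ 2)
      (Filter.Eventually.of_forall fun c => ?_)
    rw [Real.norm_eq_abs, abs_pow]
    exact pow_le_pow_left₀ (abs_nonneg _) (hN c) 2
  have hS : MeasurableSet {c | (k : ℝ) ≤ ballCount ρ V c} := measurableSet_le measurable_const hm
  have i3 : Integrable ({c | (k : ℝ) ≤ ballCount ρ V c}.indicator fun _ => (1 : ℝ)) :=
    (integrable_const 1).indicator hS
  -- The count `x` is an integer, so if it is below `k` it is at most `k - 1`; this is why a mean of
  -- exactly `k` suffices. Otherwise `x ≤ x² / (2Q) + 2Q` by completing the square. Integrating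
  -- gives `k ≤ (k - 1) + 1/2 + 2Q * P` for the probability `P` in question.
  have hpt : ∀ c, ballCount ρ V c ≤ ((k : ℝ) - 1) + (1 / (2 * Q) * ballCount ρ V c ^ 2 +
      2 * Q * {c | (k : ℝ) ≤ ballCount ρ V c}.indicator (fun _ => (1 : ℝ)) c) := by
    intro c
    by_cases h : (k : ℝ) ≤ ballCount ρ V c
    · rw [Set.indicator_of_mem (show c ∈ {c | (k : ℝ) ≤ ballCount ρ V c} from h)]
      have : 1 / (2 * Q) * ballCount ρ V c ^ 2 + 2 * Q - ballCount ρ V c =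
          ((ballCount ρ V c - Q) ^ 2 + 3 * Q ^ 2) / (2 * Q) := by
        field_simp
        ring
      have : 0 ≤ ((ballCount ρ V c - Q) ^ 2 + 3 * Q ^ 2) / (2 * Q) := by positivity
      have : (1 : ℝ) ≤ k := by exact_mod_cast hk
      linarith
    · rw [Set.indicator_of_notMem (show c ∉ {c | (k : ℝ) ≤ ballCount ρ V c} from h)]
      have : ballCount ρ V c ≤ k - 1 := by
        classical
        rw [ballCount_eq_card] at h ⊢
        rw [le_sub_iff_add_le]
        exact_mod_cast not_le.1 h
      have : 0 ≤ 1 / (2 * Q) * ballCount ρ V c ^ 2 := by positivity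
      linarith
  have i4 : Integrable (fun c => 1 / (2 * Q) * ballCount ρ V c ^ 2 +
      2 * Q * {c | (k : ℝ) ≤ ballCount ρ V c}.indicator (fun _ => (1 : ℝ)) c) :=
    (i2.const_mul _).add (i3.const_mul _)
  have := integral_mono i1 ((integrable_const _).add i4) hpt
  rw [integral_add' (integrable_const _) i4, integral_add (i2.const_mul _) (i3.const_mul _),
    integral_const_mul, integral_const_mul, integral_indicator_const _ hS] at this
  simp only [integral_const, probReal_univ, smul_eq_mul, one_mul, mul_one] at this
  have h3 : 1 / (2 * Q) * ∫ c, ballCount ρ V c ^ 2 ≤ 1 / 2 := by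
    calc _ ≤ 1 / (2 * Q) * Q := mul_le_mul_of_nonneg_left h2 (by positivity)
      _ = 1 / 2 := by field_simp
  rw [div_le_iff₀ (by positivity)]
  nlinarith

/-- With high probability there are few pairs of close points. -/
theorem volume_closePairs_le {r : ℝ} (hr : 0 ≤ r) (hn : 0 < n) :
    volume.real {V : Fin n → Torus d | 2 * n + n ^ 2 * (2 * r) ^ d < closePairs r V} ≤
      4 * (2 * r) ^ d := by
  have hbr : min 1 (2 * r) ^ d ≤ (2 * r) ^ d :=
    pow_le_pow_left₀ (by positivity) (min_le_right _ _) d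
  have hm : Measurable (Function.uncurry fun y x : Torus d =>
      (Metric.closedBall x r).indicator (fun _ => (1 : ℝ)) y) := by
    classical
    have : (Function.uncurry fun y x : Torus d =>
        (Metric.closedBall x r).indicator (fun _ => (1 : ℝ)) y) =
        {z : Torus d × Torus d | dist z.1 z.2 ≤ r}.indicator fun _ => 1 := by
      ext z
      simp only [Function.uncurry, Set.indicator_apply, Metric.mem_closedBall, Set.mem_ofPred_eq]
    rw [this]
    exact measurable_const.indicator (measurableSet_le (by fun_prop) measurable_const)
  have key := measureReal_lt_sum_sum_le (volume : Measure (Torus d)) hm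
    (fun y x => by
      classical
      simp only [Set.indicator_apply]
      split_ifs <;> simp)
    (fun y x => by
      classical
      simp only [Set.indicator_apply, Metric.mem_closedBall, dist_comm])
    (b := min 1 (2 * r) ^ d)
    (fun x => by
      rw [integral_indicator_const _ Metric.isClosed_closedBall.measurableSet,
        volume_real_torus_closedBall _ hr, smul_eq_mul, mul_one]) hn
  rw [← volume_pi] at key
  refine le_trans (measureReal_mono fun V hV => ?_) (key.trans (by linarith))
  simp only [Set.mem_ofPred_eq] at hV ⊢
  have h3 := mul_le_mul_of_nonneg_left hbr (sq_nonneg (n : ℝ))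
  unfold closePairs at hV
  linarith

end Balls

/-! ### A single clause is nice with constant probability. -/

/-- If the positions of the variables have few close pairs, a random clause is nice with
probability bounded from below. -/
theorem lintegral_drawExp_le {n k d : ℕ} (hk : 1 ≤ k) (hkn : k ≤ n) (hd : 1 ≤ d) {p : ℕ∞}
    (hp : 1 ≤ p) {T : ℝ} (hT0 : 0 < T) (hT1 : T < 1) {B : ℝ} (hB : 1 ≤ B) {w : Fin n → ℝ}
    (hw : ∀ v, 1 ≤ w v) (hW : ∑ v, w v ≤ B * n) {ρ Q M C : ℝ} (hρ : 0 < ρ)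
    (hρn : (2 * ρ) ^ d = k / n) (hQ : Q = k * (2 + 2 ^ d * k)) (hM : M = B * d ^ d * k / (1 - T))
    (hC : C = 8 * Q * M) {V : Fin n → Torus d}
    (hV : closePairs (2 * ρ) V ≤ 2 * n + n ^ 2 * (2 * (2 * ρ)) ^ d) {ζ : ℝ} (hζ0 : 0 ≤ ζ)
    (hζ1 : ζ ≤ 1) :
    ∫⁻ c, drawExp k (ENNReal.ofReal ζ) (fun v => connWeight p T (w v) c (V v)) ≤
      ENNReal.ofReal (1 - (1 - ζ) * (1 / C) ^ k * (1 / (8 * Q))) := by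
  classical
  have hk1 : (1 : ℝ) ≤ k := by exact_mod_cast hk
  have hkn' : (k : ℝ) ≤ n := by exact_mod_cast hkn
  have hn : (0 : ℝ) < n := by linarith
  have hd1 : (1 : ℝ) ≤ d := by exact_mod_cast hd
  have hdd : (1 : ℝ) ≤ d ^ d := one_le_pow₀ hd1
  have hQ1 : 1 ≤ Q := by
    rw [hQ]
    have : (0 : ℝ) ≤ 2 ^ d * k := by positivity
    nlinarith
  have hM1 : 1 ≤ M := by
    rw [hM, le_div_iff₀ (by linarith)]
    have : 1 ≤ B * d ^ d * k := one_le_mul_of_one_le_of_one_le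
      (one_le_mul_of_one_le_of_one_le hB hdd) hk1
    linarith
  have hC1 : 1 ≤ C := by rw [hC]; nlinarith
  have hρ1 : 2 * ρ ≤ 1 := by
    refine le_of_pow_le_pow_left₀ (by omega : d ≠ 0) zero_le_one ?_
    rw [hρn, one_pow, div_le_one hn]
    exact hkn'
  have hmin : min 1 (2 * ρ) ^ d = k / n := by rw [min_eq_right hρ1, hρn]
  -- many clauses have enough variables nearby
  have hcount : 1 / (4 * Q) ≤ volume.real {c | (k : ℝ) ≤ ballCount ρ V c} := by
    refine le_volume_ballCount hk (by linarith) V ?_ ?_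
    · rw [integral_ballCount hρ.le, hmin]
      field_simp
      exact le_rfl
    · refine (integral_ballCount_sq_le hρ.le V).trans ?_
      rw [hmin]
      calc (k : ℝ) / n * closePairs (2 * ρ) V
          ≤ k / n * (2 * n + n ^ 2 * (2 * (2 * ρ)) ^ d) :=
            mul_le_mul_of_nonneg_left hV (by positivity)
        _ = Q := by
            rw [mul_pow 2 (2 * ρ), hρn, hQ]
            field_simp
  -- few clauses have a large total truncated weight
  set R : ℝ := (d * ρ) ^ d with hR
  have hR0 : 0 < R := by positivity
  have hRn : 2 ^ d * R = d ^ d * (k / n) := by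
    rw [← hρn, hR, ← mul_pow, ← mul_pow]
    ring
  -- The weight that `le_connWeight` guarantees to every variable within sup-distance `ρ` of the
  -- clause.
  set τ : ℝ := (1 / R) ^ (1 / T) with hτ
  have hτ0 : 0 < τ := by positivity
  set Y : Torus d → ℝ := fun c => ∑ v, min (connWeight p T (w v) c (V v) / τ) 1 with hY
  have hXm : Measurable fun (c : Torus d) v => connWeight p T (w v) c (V v) :=
    measurable_connWeight_comp p T w measurable_id measurable_const
  have hXm' : ∀ v, Measurable fun c : Torus d => connWeight p T (w v) c (V v) :=
    fun v => measurable_pi_iff.1 hXm v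
  have hterm : ∀ v, Measurable fun c : Torus d => min (connWeight p T (w v) c (V v) / τ) 1 :=
    fun v => ((hXm' v).div_const _).min measurable_const
  have hYm : Measurable Y := Finset.measurable_sum _ fun v _ => hterm v
  have hw0 : ∀ v, 0 < w v := fun v => zero_lt_one.trans_le (hw v)
  have hY0' : ∀ c v, 0 ≤ min (connWeight p T (w v) c (V v) / τ) 1 := fun c v =>
    le_min (div_nonneg (connWeight_nonneg p T (hw0 v).le _ _) hτ0.le) zero_le_one
  have hY0 : ∀ c, 0 ≤ Y c := fun c => Finset.sum_nonneg fun v _ => hY0' c v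
  have hYn : ∀ c, Y c ≤ n := fun c =>
    (Finset.sum_le_sum fun v _ => min_le_right _ _).trans (by simp)
  have hYi : Integrable Y := Integrable.of_bound hYm.aestronglyMeasurable n
    (Filter.Eventually.of_forall fun c => by
      rw [Real.norm_eq_abs, abs_of_nonneg (hY0 c)]; exact hYn c)
  have hYint : ∫ c, Y c ≤ M := by
    rw [integral_eq_lintegral_of_nonneg_ae (Filter.Eventually.of_forall hY0)
      hYm.aestronglyMeasurable]
    refine ENNReal.toReal_le_of_le_ofReal (by linarith) ?_
    calc ∫⁻ c, ENNReal.ofReal (Y c)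
        = ∑ v, ∫⁻ c, ENNReal.ofReal (min (connWeight p T (w v) c (V v) / τ) 1) := by
          rw [← lintegral_finsetSum _ fun v _ => (hterm v).ennreal_ofReal]
          exact lintegral_congr fun c => ENNReal.ofReal_sum_of_nonneg fun v _ => hY0' c v
      _ ≤ ∑ v, ENNReal.ofReal (2 ^ d * w v * R / (1 - T)) := Finset.sum_le_sum fun v _ =>
          lintegral_min_connWeight_le hd hp hT0 hT1 (hw0 v) hR0 (V v)
      _ = ENNReal.ofReal (∑ v, 2 ^ d * w v * R / (1 - T)) :=
          (ENNReal.ofReal_sum_of_nonneg fun v _ => div_nonneg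
            (mul_nonneg (mul_nonneg (by positivity) (hw0 v).le) hR0.le) (by linarith)).symm
      _ ≤ ENNReal.ofReal M := by
          refine ENNReal.ofReal_le_ofReal ?_
          have : ∑ v, 2 ^ d * w v * R / (1 - T) = (∑ v, w v) * (d ^ d * (k / n) / (1 - T)) := by
            rw [Finset.sum_mul, ← hRn]
            exact Finset.sum_congr rfl fun v _ => by ring
          rw [this]
          calc (∑ v, w v) * (d ^ d * (k / n) / (1 - T))
              ≤ (B * n) * (d ^ d * (k / n) / (1 - T)) :=
                mul_le_mul_of_nonneg_right hW (div_nonneg (by positivity) (by linarith))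
            _ = M := by rw [hM]; field_simp
  have hYlarge : volume.real {c | C ≤ Y c} ≤ 1 / (8 * Q) := by
    have h := (mul_meas_ge_le_integral_of_nonneg (Filter.Eventually.of_forall hY0) hYi C).trans
      hYint
    rw [le_div_iff₀ (by linarith)]
    refine le_of_mul_le_mul_right ?_ (by linarith : 0 < M)
    rw [hC] at h
    calc _ = 8 * Q * M * volume.real {c | C ≤ Y c} := by ring
      _ ≤ M := by rw [hC]; exact h
      _ = 1 * M := (one_mul M).symm
  -- The clause positions with `k` heavy variables and a bounded truncated total; the volume left is
  -- at least `1/(4Q) - 1/(8Q)`.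
  set U : Set (Torus d) := {c | (k : ℝ) ≤ ballCount ρ V c} \ {c | C ≤ Y c} with hU
  have hUm : MeasurableSet U :=
    (measurableSet_le measurable_const (measurable_ballCount ρ V)).diff
      (measurableSet_le measurable_const hYm)
  have hUvol : 1 / (8 * Q) ≤ volume.real U := by
    have h1 := le_measureReal_sdiff (μ := (volume : Measure (Torus d)))
      (s₁ := {c | (k : ℝ) ≤ ballCount ρ V c}) (s₂ := {c | C ≤ Y c})
    have h2 : 1 / (4 * Q) = 1 / (8 * Q) + 1 / (8 * Q) := by field_simp; norm_num
    linarith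
  set g : ℝ := (1 - ζ) * (1 / C) ^ k with hg
  have hg0 : 0 ≤ g := mul_nonneg (by linarith) (by positivity)
  have hg1 : g ≤ 1 := by
    have : (1 / C) ^ k ≤ 1 := pow_le_one₀ (by positivity) ((div_le_one (by linarith)).2 hC1)
    exact mul_le_one₀ (by linarith) (by positivity) this
  have hpt : ∀ᵐ c, drawExp k (ENNReal.ofReal ζ) (fun v => connWeight p T (w v) c (V v)) ≤
      ENNReal.ofReal (1 - g * U.indicator (fun _ => (1 : ℝ)) c) := by
    filter_upwards [ae_ne_positions hd V] with c hc
    have hX : ∀ v, 0 < connWeight p T (w v) c (V v) := fun v => connWeight_pos hp (hw v) (hc v)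
    by_cases hcU : c ∈ U
    · rw [Set.indicator_of_mem hcU, mul_one]
      have h1 : (k : ℝ) ≤ ballCount ρ V c := hcU.1
      have h2 : ∑ v, min (connWeight p T (w v) c (V v) / τ) 1 ≤ C := (not_le.1 hcU.2).le
      rw [ballCount_eq_card, Nat.cast_le] at h1
      have h3 : k ≤ (Finset.univ.filter fun v => τ ≤ connWeight p T (w v) c (V v)).card := by
        refine h1.trans (Finset.card_le_card fun v hv => ?_)
        simp only [Finset.mem_filter, Finset.mem_univ, true_and] at hv ⊢
        exact le_connWeight hd hp hT0 (hw v) (hc v) hv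
      obtain ⟨t, ht, hgt⟩ := exists_sorted_drawProb_ge hX hτ0 h2 h3
      exact drawExp_le_of_sorted hkn hX hζ0 hζ1 ht hgt
    · rw [Set.indicator_of_notMem hcU, mul_zero, sub_zero, ENNReal.ofReal_one]
      refine drawExp_le_one hkn hX ?_
      exact ENNReal.ofReal_le_one.2 hζ1
  have hind : Integrable (fun c => g * U.indicator (fun _ => (1 : ℝ)) c) :=
    ((integrable_const 1).indicator hUm).const_mul g
  refine (lintegral_mono_ae hpt).trans ?_
  have hdiff : Integrable (fun c => 1 - g * U.indicator (fun _ => (1 : ℝ)) c) :=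
    (integrable_const 1).sub hind
  rw [← ofReal_integral_eq_lintegral_ofReal hdiff
    (Filter.Eventually.of_forall fun c => by
      by_cases hcU : c ∈ U
      · simp [Set.indicator_of_mem hcU, hg1]
      · simp [Set.indicator_of_notMem hcU])]
  refine ENNReal.ofReal_le_ofReal ?_
  rw [integral_sub (integrable_const _) hind, integral_const_mul, integral_indicator_const _ hUm]
  simp only [integral_const, probReal_univ, smul_eq_mul, mul_one]
  have := mul_le_mul_of_nonneg_left hUvol hg0
  linarith

/-! ### Marginal law of the variable positions, Chernoff bound and conclusion. -/

/-- The case `z = 1` of `lintegral_geometricModel`: given `V`, everything else has total mass `1`,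
so the variables stay uniform under the density. It also shows that the model is a probability
measure. -/
theorem lintegral_varPos_geometricModel {n m k d : ℕ} (hkn : k ≤ n) (hd : 1 ≤ d) {p : ℕ∞}
    (hp : 1 ≤ p) (T : ℝ) {w : Fin n → ℝ} (hw : ∀ v, 1 ≤ w v)
    {G : (Fin n → Torus d) → ENNReal} (hG : Measurable G) :
    ∫⁻ Φ, G Φ.varPos ∂(geometricModel n m k d p T w) = ∫⁻ V, G V := by
  have h := lintegral_geometricModel (k := k) (m := m) p T hw 1 hG
  simp only [one_pow, mul_one] at h
  rw [h]
  refine lintegral_congr fun V => ?_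
  have : ∫⁻ c, drawExp k 1 (fun v => connWeight p T (w v) c (V v)) = 1 := by
    have h1 : ∀ᵐ c, drawExp k 1 (fun v => connWeight p T (w v) c (V v)) = 1 := by
      filter_upwards [ae_ne_positions hd V] with c hc
      exact drawExp_one hkn fun v => connWeight_pos hp (hw v) (hc v)
    rw [lintegral_congr_ae h1]
    simp
  rw [this, one_pow, mul_one]

theorem isProbabilityMeasure_geometricModel {n m k d : ℕ} (hkn : k ≤ n) (hd : 1 ≤ d) {p : ℕ∞}
    (hp : 1 ≤ p) (T : ℝ) {w : Fin n → ℝ} (hw : ∀ v, 1 ≤ w v) :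
    IsProbabilityMeasure (geometricModel n m k d p T w) := by
  have h := lintegral_varPos_geometricModel (k := k) (m := m) hkn hd hp T hw
    (G := fun _ => 1) measurable_const
  simp only [lintegral_const, one_mul, measure_univ] at h
  exact ⟨h⟩

theorem geometricModel_varPos_preimage {n m k d : ℕ} (hkn : k ≤ n) (hd : 1 ≤ d) {p : ℕ∞}
    (hp : 1 ≤ p) (T : ℝ) {w : Fin n → ℝ} (hw : ∀ v, 1 ≤ w v) {A : Set (Fin n → Torus d)}
    (hA : MeasurableSet A) :
    geometricModel n m k d p T w {Φ | Φ.varPos ∈ A} = volume A := by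
  have h := lintegral_varPos_geometricModel (k := k) (m := m) hkn hd hp T hw
    (G := A.indicator 1) (measurable_one.indicator hA)
  rw [lintegral_indicator_one hA] at h
  have hm : Measurable fun Φ : GeomFormula n m k d => Φ.varPos :=
    measurable_fst.comp measurable_fst
  rw [← h]
  exact (lintegral_indicator_one (hm hA)).symm

/-- Chernoff bound for the number of nice clauses, on an event that concerns the positions of the
variables and that makes every clause nice with probability bounded from below. -/
theorem geometricModel_numNice_lt_le {n m k d : ℕ} (p : ℕ∞) (T : ℝ) {w : Fin n → ℝ}
    (hw : ∀ v, 1 ≤ w v) {A : Set (Fin n → Torus d)} (hA : MeasurableSet A) {q : ℝ}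
    (hq : ∀ V ∈ A, ∫⁻ c, drawExp k (ENNReal.ofReal (Real.exp (-1)))
      (fun v => connWeight p T (w v) c (V v)) ≤ ENNReal.ofReal (1 - q)) :
    geometricModel n m k d p T w {Φ | Φ.varPos ∈ A ∧ (Φ.numNice p T w : ℝ) < q / 2 * m} ≤
      ENNReal.ofReal (Real.exp (-(q / 2 * m))) := by
  set z := ENNReal.ofReal (Real.exp (-1)) with hz
  -- Markov's inequality is applied to `exp (q / 2 * m - N)` restricted to `A`, which is at least
  -- `1` on the event to be bounded.
  set G : (Fin n → Torus d) → ENNReal :=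
    A.indicator fun _ => ENNReal.ofReal (Real.exp (q / 2 * m)) with hG
  have hGm : Measurable G := measurable_const.indicator hA
  have hF : Measurable fun Φ : GeomFormula n m k d => G Φ.varPos * z ^ Φ.numNice p T w :=
    (hGm.comp (measurable_fst.comp measurable_fst)).mul (measurable_pow_numNice p T w z)
  have hmark := mul_meas_ge_le_lintegral (μ := geometricModel n m k d p T w) hF 1
  rw [one_mul, lintegral_geometricModel p T hw z hGm] at hmark
  refine (measure_mono fun Φ hΦ => ?_).trans (hmark.trans ?_)
  · simp only [Set.mem_ofPred_eq] at hΦ ⊢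
    rw [hG, Set.indicator_of_mem hΦ.1, hz, ← ENNReal.ofReal_pow (Real.exp_pos _).le,
      ← Real.exp_nat_mul, ← ENNReal.ofReal_mul (Real.exp_pos _).le, ← Real.exp_add,
      ENNReal.one_le_ofReal]
    exact Real.one_le_exp (by linarith [hΦ.2])
  · have hle : ∀ V, G V * (∫⁻ c, drawExp k z (fun v => connWeight p T (w v) c (V v))) ^ m ≤
        ENNReal.ofReal (Real.exp (-(q / 2 * m))) := by
      intro V
      by_cases hV : V ∈ A
      · rw [hG, Set.indicator_of_mem hV]
        -- Uses `1 - q ≤ exp (-q)`; the `m` clauses contribute `exp (-q * m)`, half of which cancels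
        -- the prefactor.
        calc _ ≤ ENNReal.ofReal (Real.exp (q / 2 * m)) * ENNReal.ofReal (Real.exp (-q)) ^ m := by
              gcongr
              refine (hq V hV).trans (ENNReal.ofReal_le_ofReal ?_)
              linarith [Real.add_one_le_exp (-q)]
          _ = _ := by
              rw [← ENNReal.ofReal_pow (Real.exp_pos _).le, ← Real.exp_nat_mul,
                ← ENNReal.ofReal_mul (Real.exp_pos _).le, ← Real.exp_add]
              congr 2
              ring
      · rw [hG, Set.indicator_of_notMem hV, zero_mul]
        exact zero_le
    refine (lintegral_mono hle).trans ?_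
    simp

theorem measurable_closePairs {n d : ℕ} (r : ℝ) :
    Measurable (closePairs r : (Fin n → Torus d) → ℝ) := by
  classical
  have : (closePairs r : (Fin n → Torus d) → ℝ) = fun V => ∑ u, ∑ v,
      {V : Fin n → Torus d | dist (V u) (V v) ≤ r}.indicator (fun _ => (1 : ℝ)) V := by
    ext V
    simp only [closePairs, Set.indicator_apply, Metric.mem_closedBall, Set.mem_ofPred_eq]
  rw [this]
  refine Finset.measurable_sum _ fun u _ => Finset.measurable_sum _ fun v _ => ?_
  exact measurable_const.indicator (measurableSet_le
    ((measurable_pi_apply u).dist (measurable_pi_apply v)) measurable_const)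

theorem numNice_le {n m k d : ℕ} (p : ℕ∞) (T : ℝ) (w : Fin n → ℝ) (Φ : GeomFormula n m k d) :
    Φ.numNice p T w ≤ m := by
  unfold GeomFormula.numNice
  exact (Set.ncard_le_card _).trans (by simp)

theorem mainTheorem7 (k d : ℕ) (hk : 1 ≤ k) (hd : 1 ≤ d) (p : ℕ∞) (hp : 1 ≤ p)
    (T : ℝ) (hT0 : 0 < T) (hT1 : T < 1) (ε : ℝ) (hε : 0 < ε)
    (α β B D : ℝ) (hα : 0 < α) :
    ∃ a b K : ℝ, ∃ n₀ : ℕ, 0 < a ∧ 0 < b ∧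
      ∀ n m : ℕ, n₀ ≤ n → α * n ≤ m → (m : ℝ) ≤ β * n →
      ∀ w : Fin n → ℝ, (∀ v, 1 ≤ w v) → (∃ v, w v = 1) →
        ∑ v, w v ≤ B * n → (∀ v, w v ≤ D * (n : ℝ) ^ (1 - ε)) →
        1 - K / n ≤ (geometricModel n m k d p T w).real
          {Φ | a * m ≤ (Φ.numNice p T w : ℝ) ∧ (Φ.numNice p T w : ℝ) ≤ b * m} := by
  have hk1 : (1 : ℝ) ≤ k := by exact_mod_cast hk
  have hd1 : (1 : ℝ) ≤ d := by exact_mod_cast hd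
  -- `Q` bounds the second moment of the number of nearby variables, and `M` the mean of the total
  -- truncated weight in units of `τ`. `C` makes Markov's exceptional set at most `1 / (8 * Q)`, and
  -- `q` is the resulting gap of the one-clause generating function at `exp (-1)`. Replacing `B` by
  -- `max B 1` keeps these constants positive.
  obtain ⟨Q, hQ⟩ : ∃ Q : ℝ, Q = k * (2 + 2 ^ d * k) := ⟨_, rfl⟩
  obtain ⟨M, hM⟩ : ∃ M : ℝ, M = max B 1 * d ^ d * k / (1 - T) := ⟨_, rfl⟩
  obtain ⟨C, hC⟩ : ∃ C : ℝ, C = 8 * Q * M := ⟨_, rfl⟩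
  obtain ⟨q, hq⟩ : ∃ q : ℝ, q = (1 - Real.exp (-1)) * (1 / C) ^ k * (1 / (8 * Q)) := ⟨_, rfl⟩
  have hQ0 : 0 < Q := by rw [hQ]; positivity
  have hM0 : 0 < M := by rw [hM]; exact div_pos (by positivity) (by linarith)
  have hC0 : 0 < C := by rw [hC]; positivity
  have hexp : Real.exp (-1) < 1 := 
    (Real.exp_lt_exp.2 (by norm_num)).trans_eq Real.exp_zero
  have hq0 : 0 < q := by
    rw [hq]
    exact mul_pos (mul_pos (by linarith) (by positivity)) (by positivity)
  -- The two terms of `K` pay for too many close pairs and for the Chernoff bound; `n₀ = k` ensures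
  -- that `k` distinct variables exist.
  refine ⟨q / 2, 1, 4 * 2 ^ d * k + 2 / (q * α), k, by positivity, one_pos, ?_⟩
  intro n m hkn hαm _ w hw _ hW _
  have hkn' : (k : ℝ) ≤ n := by exact_mod_cast hkn
  have hn : (0 : ℝ) < n := by linarith
  have hm : (0 : ℝ) < m := lt_of_lt_of_le (by positivity) hαm
  have hW' : ∑ v, w v ≤ max B 1 * n :=
    hW.trans (mul_le_mul_of_nonneg_right (le_max_left _ _) hn.le)
  -- A sup-ball of radius `ρ` has volume `k / n`, so it contains `k` variables on average.
  obtain ⟨ρ, hρ, hρn⟩ : ∃ ρ : ℝ, 0 < ρ ∧ (2 * ρ) ^ d = k / n := by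
    refine ⟨((k : ℝ) / n) ^ (1 / (d : ℝ)) / 2, by positivity, ?_⟩
    rw [mul_div_cancel₀ _ two_ne_zero, ← Real.rpow_natCast, ← Real.rpow_mul (by positivity),
      one_div_mul_cancel (by positivity), Real.rpow_one]
  have := isProbabilityMeasure_geometricModel (m := m) hkn hd hp T hw
  set A : Set (Fin n → Torus d) :=
    {V | 2 * n + n ^ 2 * (2 * (2 * ρ)) ^ d < closePairs (2 * ρ) V} with hA
  have hAm : MeasurableSet A := measurableSet_lt measurable_const (measurable_closePairs _)
  have h1 : (geometricModel n m k d p T w).real {Φ | Φ.varPos ∈ A} ≤ 4 * 2 ^ d * k / n := by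
    rw [Measure.real, geometricModel_varPos_preimage hkn hd hp T hw hAm]
    refine (volume_closePairs_le (by positivity) (by exact_mod_cast hn)).trans (le_of_eq ?_)
    rw [mul_pow 2 (2 * ρ), hρn]
    ring
  have h2 : (geometricModel n m k d p T w).real
      {Φ | Φ.varPos ∈ Aᶜ ∧ (Φ.numNice p T w : ℝ) < q / 2 * m} ≤ 2 / (q * α) / n := by
    refine ENNReal.toReal_le_of_le_ofReal (by positivity)
      ((geometricModel_numNice_lt_le p T hw hAm.compl fun V hV => ?_).trans
        (ENNReal.ofReal_le_ofReal ?_))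
    · rw [hq]
      exact lintegral_drawExp_le hk hkn hd hp hT0 hT1 (le_max_right B 1) hw hW' hρ hρn hQ hM hC
        (not_lt.1 hV) (Real.exp_pos _).le hexp.le
    · have h3 : q / 2 * (α * n) ≤ q / 2 * m := mul_le_mul_of_nonneg_left hαm (by positivity)
      have h4 : 0 < q / 2 * (α * n) := by positivity
      calc Real.exp (-(q / 2 * m)) ≤ Real.exp (-(q / 2 * (α * n))) :=
            Real.exp_le_exp.2 (by linarith)
        -- The exponential decay is weakened to `exp (-x) ≤ 1 / x`, which already has the order of
        -- the close-pairs error.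
        _ ≤ 1 / (q / 2 * (α * n)) := by
            rw [Real.exp_neg, one_div]
            exact inv_anti₀ h4 (by linarith [Real.add_one_le_exp (q / 2 * (α * n))])
        _ = 2 / (q * α) / n := by field_simp
  have hcover : (Set.univ : Set (GeomFormula n m k d)) ⊆
      {Φ | q / 2 * m ≤ (Φ.numNice p T w : ℝ) ∧ (Φ.numNice p T w : ℝ) ≤ 1 * m} ∪
        ({Φ | Φ.varPos ∈ A} ∪ {Φ | Φ.varPos ∈ Aᶜ ∧ (Φ.numNice p T w : ℝ) < q / 2 * m}) := by
    intro Φ _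
    have hle : (Φ.numNice p T w : ℝ) ≤ 1 * m := by
      rw [one_mul]; exact_mod_cast numNice_le p T w Φ
    by_cases hN : q / 2 * m ≤ (Φ.numNice p T w : ℝ)
    · exact Or.inl ⟨hN, hle⟩
    · by_cases hV : Φ.varPos ∈ A
      · exact Or.inr (Or.inl hV)
      · exact Or.inr (Or.inr ⟨hV, not_le.1 hN⟩)
  have h5 := measureReal_mono (μ := geometricModel n m k d p T w) hcover
  rw [probReal_univ] at h5
  have h6 := h5.trans ((measureReal_union_le _ _).trans
    (add_le_add le_rfl (measureReal_union_le _ _)))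
  rw [add_div]
  linarith
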